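/- Let $n\in\mathbb{N}$ and let $\Omega\subset\mathbb{C}^n$ be a bounded Reinhardt domain, i.e. a nonempty bounded connected open set such that $(e^{i\theta_1}z_1,\dots,e^{i\theta_n}z_n)\in\Omega$ for all $z\in\Omega$ and $\theta_1,\dots,\theta_n\in\mathbb{R}$. Let $A^2(\Omega)$ be the closed subspace of $L^2(\Omega)$ (with respect to Lebesgue measure) that consists of the square integrable holomorphic functions on $\Omega$, let $P:L^2(\Omega)\to A^2(\Omega)$ be the orthogonal projection, and for $\phi\in L^\infty(\Omega)$ let $T_\phi:A^2(\Omega)\to A^2(\Omega)$, $T_\phi f=P(\phi f)$, be the Toeplitz operator with symbol $\phi$. A function $\phi$ on $\Omega$ is called quasi-homogeneous if there are $f:[0,\infty)^n\to\mathbb{C}$ and $(k_1,\dots,k_n)\in\mathbb{Z}^n$ such that $$\phi(r_1e^{i\theta_1},\dots,r_ne^{i\theta_n})=f(r_1,\dots,r_n)\,e^{i(k_1\theta_1+\cdots+k_n\theta_n)}$$ for all $r\in[0,\infty)^n$ and $\theta\in\mathbb{R}^n$ with $(r_1e^{i\theta_1},\dots,r_ne^{i\theta_n})\in\Omega$. Let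 $m\ge 1$ and $\phi_1,\dots,\phi_m\in L^\infty(\Omega)$, where each of $\phi_1,\dots,\phi_{m-1}$ agrees almost everywhere on $\Omega$ with a quasi-homogeneous function, while $\phi_m$ is arbitrary. If $T_{\phi_m}T_{\phi_{m-1}}\cdots T_{\phi_1}=0$ on $A^2(\Omega)$, then $\phi_j=0$ (almost everywhere on $\Omega$) for some $j\in\{1,\dots,m\}$. -/

import Mathlib

open MeasureTheory
open scoped ENNReal NNReal

section

open Metric Set Filter Topology

/-- Area mean value inequality on a polydisc. -/
theorem Bergman.enorm_mul_volume_ball_le {n : ℕ} {h : (Fin n → ℂ) → ℂ} {z : Fin n → ℂ} {R : ℝ}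
    (hh : DifferentiableOn ℂ h (ball z R)) :
    ‖h z‖ₑ * volume (ball (0 : Fin n → ℂ) R) ≤ ∫⁻ w in ball z R, ‖h w‖ₑ := by
  classical
  set H : (Fin n → ℂ) → ℂ := (ball z R).piecewise h 0 with hH
  have hHm : Measurable H :=
    hh.continuousOn.measurable_piecewise continuousOn_const isOpen_ball.measurableSet
  have hHe : ∫⁻ w, ‖H w‖ₑ = ∫⁻ w in ball z R, ‖h w‖ₑ := by
    rw [← lintegral_indicator isOpen_ball.measurableSet]
    refine lintegral_congr fun w => ?_
    by_cases hw : w ∈ ball z R <;> simp [hH, hw]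
  have hrot : ∀ θ : ℝ, MeasurePreserving
      (fun w : Fin n → ℂ => fun j => circleMap 0 1 θ * w j) volume volume := by
    intro θ
    refine volume_preserving_pi (fun _ => ?_)
    have := (rotation (Circle.exp θ)).measurePreserving
    have heq : (fun x : ℂ => circleMap 0 1 θ * x) = rotation (Circle.exp θ) := by
      funext x
      simp [circleMap, rotation_apply]
    change MeasurePreserving (fun x : ℂ => circleMap 0 1 θ * x) volume volume
    rw [heq]
    exact this
  have hball : ∀ w ∈ ball (0 : Fin n → ℂ) R,
      ‖h z‖ₑ * ENNReal.ofReal (2 * Real.pi) ≤ ∫⁻ θ in Ioc 0 (2 * Real.pi),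
        ‖H (z + fun j => circleMap 0 1 θ * w j)‖ₑ := by
    intro w hw
    have hw' : ‖w‖ < R := by simpa using hw
    have hmem : ∀ c : ℂ, ‖c‖ ≤ 1 → z + c • w ∈ ball z R := by
      intro c hc
      rw [mem_ball_iff_norm, add_sub_cancel_left, norm_smul]
      calc ‖c‖ * ‖w‖ ≤ 1 * ‖w‖ := by gcongr
        _ < R := by simpa using hw'
    have hd : ∀ c ∈ closedBall (0 : ℂ) 1, DifferentiableAt ℂ (fun c : ℂ => h (z + c • w)) c := by
      intro c hc
      have h1 : DifferentiableAt ℂ h (z + c • w) :=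
        hh.differentiableAt (isOpen_ball.mem_nhds (hmem c (by simpa using hc)))
      exact h1.fun_comp' c (by fun_prop)
    have hmean := circleAverage_of_differentiable_on_off_countable (R := 1) (c := 0)
      (f := fun c : ℂ => h (z + c • w)) countable_empty
      (fun c hc => (hd c (by simpa using hc)).continuousAt.continuousWithinAt)
      (fun c hc => hd c (ball_subset_closedBall (by simpa using hc)))
    have hval : ∀ θ : ℝ, H (z + fun j => circleMap 0 1 θ * w j) = h (z + circleMap 0 1 θ • w) := by
      intro θ
      have : z + circleMap 0 1 θ • w ∈ ball z R := hmem _ (by simp)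
      have h2 : (fun j => circleMap 0 1 θ * w j) = circleMap 0 1 θ • w := by
        funext j; simp
      rw [h2, hH, piecewise_eq_of_mem _ _ _ this]
    have hmul : h z * ((2 * Real.pi : ℝ) : ℂ) =
        ∫ θ in Ioc 0 (2 * Real.pi), h (z + circleMap 0 1 θ • w) := by
      rw [← intervalIntegral.integral_of_le (by positivity)]
      have hpi : ((2 * Real.pi : ℝ) : ℂ) ≠ 0 := by
        exact_mod_cast (by positivity : (2 * Real.pi) ≠ 0)
      simp only [Real.circleAverage_def, zero_smul, add_zero] at hmean
      rw [← hmean, Complex.real_smul]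
      push_cast at hpi ⊢
      field_simp
    calc ‖h z‖ₑ * ENNReal.ofReal (2 * Real.pi)
        = ‖h z * ((2 * Real.pi : ℝ) : ℂ)‖ₑ := by
          rw [enorm_mul]
          congr 1
          rw [← ofReal_norm, Complex.norm_real, Real.norm_of_nonneg (by positivity)]
      _ ≤ ∫⁻ θ in Ioc 0 (2 * Real.pi), ‖h (z + circleMap 0 1 θ • w)‖ₑ := by
          rw [hmul]; exact enorm_integral_le_lintegral_enorm _
      _ = _ := by simp only [hval]
  have hmeas : Measurable (fun p : (Fin n → ℂ) × ℝ =>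
      ‖H (z + fun j => circleMap 0 1 p.2 * p.1 j)‖ₑ) := by
    refine (hHm.comp ?_).enorm
    have : Continuous (fun p : (Fin n → ℂ) × ℝ => z + fun j => circleMap 0 1 p.2 * p.1 j) := by
      have := continuous_circleMap 0 1
      fun_prop
    exact this.measurable
  have hswap : (∫⁻ w : Fin n → ℂ, ∫⁻ θ in Ioc 0 (2 * Real.pi), ‖H (z + fun j => circleMap 0 1 θ * w j)‖ₑ) =
      ∫⁻ θ in Ioc 0 (2 * Real.pi), ∫⁻ w : Fin n → ℂ, ‖H (z + fun j => circleMap 0 1 θ * w j)‖ₑ := by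
    apply lintegral_lintegral_swap
    exact hmeas.aemeasurable
  have key : ENNReal.ofReal (2 * Real.pi) * (‖h z‖ₑ * volume (ball (0 : Fin n → ℂ) R)) ≤
      ENNReal.ofReal (2 * Real.pi) * ∫⁻ w in ball z R, ‖h w‖ₑ := by
    have e1 : ENNReal.ofReal (2 * Real.pi) * (‖h z‖ₑ * volume (ball (0 : Fin n → ℂ) R)) =
        ∫⁻ _ in ball (0 : Fin n → ℂ) R, ‖h z‖ₑ * ENNReal.ofReal (2 * Real.pi) := by
      rw [setLIntegral_const]; ring
    have e2 : ∀ θ : ℝ, (∫⁻ w : Fin n → ℂ, ‖H (z + fun j => circleMap 0 1 θ * w j)‖ₑ) =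
        ∫⁻ w in ball z R, ‖h w‖ₑ := by
      intro θ
      have h1 := (hrot θ).lintegral_comp (f := fun w => ‖H (z + w)‖ₑ)
        ((hHm.comp (measurable_const_add z)).enorm)
      rw [h1, lintegral_add_left_eq_self (fun w => ‖H w‖ₑ) z, hHe]
    have e3 : (∫⁻ _ in Ioc 0 (2 * Real.pi), ∫⁻ w in ball z R, ‖h w‖ₑ) =
        ENNReal.ofReal (2 * Real.pi) * ∫⁻ w in ball z R, ‖h w‖ₑ := by
      rw [setLIntegral_const, Real.volume_Ioc, sub_zero, mul_comm]
    rw [e1, ← e3]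
    simp only [e2] at hswap
    rw [← hswap]
    refine (setLIntegral_mono' isOpen_ball.measurableSet hball).trans ?_
    exact lintegral_mono' Measure.restrict_le_self le_rfl
  exact (ENNReal.mul_le_mul_iff_right (by simp [Real.pi_pos]) ENNReal.ofReal_ne_top).1 key

/-- Point evaluations on a ball are bounded in the `L²` norm. -/
theorem Bergman.norm_le {n : ℕ} (R : ℝ) (hR : 0 < R) : ∃ C : ℝ, 0 ≤ C ∧
    ∀ (Ω : Set (Fin n → ℂ)) (f : (Fin n → ℂ) → ℂ) (z : Fin n → ℂ), ball z R ⊆ Ω →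
      DifferentiableOn ℂ f Ω → MemLp f 2 (volume.restrict Ω) →
      ‖f z‖ ≤ C * (eLpNorm f 2 (volume.restrict Ω)).toReal := by
  set V := volume (ball (0 : Fin n → ℂ) R)
  have hV0 : V ≠ 0 := (measure_ball_pos _ _ hR).ne'
  have hVt : V ≠ ∞ := measure_ball_lt_top.ne
  refine ⟨Real.sqrt (V⁻¹).toReal, Real.sqrt_nonneg _, fun Ω f z hz hf hm => ?_⟩
  have h1 := Bergman.enorm_mul_volume_ball_le (h := fun w => f w ^ 2) ((hf.mono hz).pow 2)
  have h2 : ‖f z‖ₑ ^ 2 * V ≤ eLpNorm f 2 (volume.restrict Ω) ^ 2 := by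
    have h3 : eLpNorm f 2 (volume.restrict Ω) ^ 2 = ∫⁻ w in Ω, ‖f w‖ₑ ^ 2 := by
      have := eLpNorm_nnreal_pow_eq_lintegral (f := f) (μ := volume.restrict Ω) (p := 2) two_ne_zero
      simpa using this
    rw [h3]
    calc ‖f z‖ₑ ^ 2 * V ≤ ∫⁻ w in ball z R, ‖f w‖ₑ ^ 2 := by simpa [enorm_pow] using h1
      _ ≤ _ := lintegral_mono_set hz
  have h4 : ‖f z‖ ^ 2 ≤ (V⁻¹).toReal * (eLpNorm f 2 (volume.restrict Ω)).toReal ^ 2 := by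
    have h5 : ‖f z‖ₑ ^ 2 ≤ V⁻¹ * eLpNorm f 2 (volume.restrict Ω) ^ 2 := by
      rw [mul_comm, ← div_eq_mul_inv]
      exact (ENNReal.le_div_iff_mul_le (Or.inl hV0) (Or.inl hVt)).2 h2
    have h6 := ENNReal.toReal_mono (ENNReal.mul_ne_top (ENNReal.inv_ne_top.2 hV0)
      (ENNReal.pow_ne_top hm.2.ne)) h5
    simpa using h6
  calc ‖f z‖ = Real.sqrt (‖f z‖ ^ 2) := (Real.sqrt_sq (norm_nonneg _)).symm
    _ ≤ Real.sqrt ((V⁻¹).toReal * (eLpNorm f 2 (volume.restrict Ω)).toReal ^ 2) :=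
        Real.sqrt_le_sqrt h4
    _ = _ := by rw [Real.sqrt_mul ENNReal.toReal_nonneg, Real.sqrt_sq ENNReal.toReal_nonneg]

/-- The Bergman space `A²(Ω)`: the (classes of) functions in `L²(Ω)` that are holomorphic on `Ω`. -/
def bergmanSpace {n : ℕ} (Ω : TopologicalSpace.Opens (Fin n → ℂ)) :
    Submodule ℂ (Lp ℂ 2 (volume.restrict (Ω : Set (Fin n → ℂ)))) where
  carrier := {u | ∃ f : (Fin n → ℂ) → ℂ, DifferentiableOn ℂ f Ω ∧
    u =ᵐ[volume.restrict (Ω : Set (Fin n → ℂ))] f}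
  add_mem' := by
    rintro u v ⟨f, hf, huf⟩ ⟨g, hg, hvg⟩
    exact ⟨f + g, hf.add hg, (Lp.coeFn_add u v).trans (huf.add hvg)⟩
  zero_mem' := ⟨0, differentiableOn_const 0, Lp.coeFn_zero _ _ _⟩
  smul_mem' := by
    rintro c u ⟨f, hf, huf⟩
    exact ⟨c • f, hf.const_smul c, (Lp.coeFn_smul c u).trans (huf.const_smul c)⟩

/-- The Bergman space is closed in `L²(Ω)`. -/
theorem bergmanSpace_isClosed {n : ℕ} (Ω : TopologicalSpace.Opens (Fin n → ℂ)) :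
    IsClosed (bergmanSpace Ω : Set (Lp ℂ 2 (volume.restrict (Ω : Set (Fin n → ℂ))))) := by
  set μ := volume.restrict (Ω : Set (Fin n → ℂ)) with hμ
  refine IsSeqClosed.isClosed fun u U hu hlim => ?_
  choose f hf huf using hu
  have hdiff : ∀ i j, MemLp (fun w => f i w - f j w) 2 μ ∧
      (eLpNorm (fun w => f i w - f j w) 2 μ).toReal = ‖u i - u j‖ := by
    intro i j
    have h1 : (u i - u j : Lp ℂ 2 μ) =ᵐ[μ] fun w => f i w - f j w :=
      (Lp.coeFn_sub (u i) (u j)).trans ((huf i).sub (huf j))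
    exact ⟨(memLp_congr_ae h1).1 (Lp.memLp _), by rw [Lp.norm_def, eLpNorm_congr_ae h1]⟩
  have hcau := hlim.cauchySeq
  have hloc : ∀ z ∈ (Ω : Set (Fin n → ℂ)), ∃ R > 0, ball z (2 * R) ⊆ Ω := by
    intro z hz
    obtain ⟨ε, hε, h⟩ := Metric.isOpen_iff.1 Ω.isOpen z hz
    exact ⟨ε / 2, by positivity, by rwa [mul_div_cancel₀ _ two_ne_zero]⟩
  have hsub : ∀ {z : Fin n → ℂ} {R : ℝ} {y : Fin n → ℂ}, y ∈ ball z R →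
      ball y R ⊆ ball z (2 * R) := fun {z R y} hy =>
    ball_subset_ball' (by have := mem_ball.1 hy; linarith)
  have hconv : ∀ z ∈ (Ω : Set (Fin n → ℂ)), ∃ l, Tendsto (fun i => f i z) atTop (𝓝 l) := by
    intro z hz
    obtain ⟨R, hR, hball⟩ := hloc z hz
    obtain ⟨C, hC, hb⟩ := Bergman.norm_le (n := n) R hR
    refine cauchySeq_tendsto_of_complete (Metric.cauchySeq_iff.2 fun ε hε => ?_)
    obtain ⟨N, hN⟩ := Metric.cauchySeq_iff.1 hcau (ε / (C + 1)) (by positivity)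
    refine ⟨N, fun i hi j hj => ?_⟩
    have h1 := hb Ω _ z ((hsub (mem_ball_self hR)).trans hball) ((hf i).sub (hf j)) (hdiff i j).1
    have h2 := hN i hi j hj
    rw [dist_eq_norm] at h2 ⊢
    calc ‖f i z - f j z‖ ≤ C * ‖u i - u j‖ := by rw [← (hdiff i j).2]; exact h1
      _ ≤ (C + 1) * ‖u i - u j‖ := by gcongr; linarith
      _ < (C + 1) * (ε / (C + 1)) := by gcongr
      _ = ε := by field_simp
  have hconv' : ∀ z, ∃ l, z ∈ (Ω : Set (Fin n → ℂ)) → Tendsto (fun i => f i z) atTop (𝓝 l) := by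
    intro z
    by_cases hz : z ∈ (Ω : Set (Fin n → ℂ))
    · obtain ⟨l, hl⟩ := hconv z hz
      exact ⟨l, fun _ => hl⟩
    · exact ⟨0, fun h => absurd h hz⟩
  choose g hg using hconv'
  refine ⟨g, fun z hz => ?_, ?_⟩
  · obtain ⟨R, hR, hball⟩ := hloc z hz
    obtain ⟨C, hC, hb⟩ := Bergman.norm_le (n := n) (R / 2) (by positivity)
    have hR2 : R / 2 > 0 := by positivity
    have hat : ∀ i, ∀ y ∈ ball z R, DifferentiableAt ℂ (f i) y := fun i y hy =>
      (hf i).differentiableAt (Ω.isOpen.mem_nhds (hball (hsub hy (mem_ball_self hR))))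
    have hder : ∀ i j, ∀ y ∈ ball z R,
        ‖fderiv ℂ (f i) y - fderiv ℂ (f j) y‖ ≤ (2 * C * ‖u i - u j‖) / (R / 2) := by
      intro i j y hy
      have hyb : ball y R ⊆ Ω := (hsub hy).trans hball
      have hbound : ∀ x ∈ ball y (R / 2), ‖f i x - f j x‖ ≤ C * ‖u i - u j‖ := by
        intro x hx
        rw [← (hdiff i j).2]
        refine hb Ω _ x ((hsub hx).trans ?_) ((hf i).sub (hf j)) (hdiff i j).1
        rwa [mul_div_cancel₀ _ two_ne_zero]
      rw [← fderiv_sub (hat i y hy) (hat j y hy)]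
      refine Complex.norm_fderiv_le_div_of_mapsTo_ball
        (((hf i).sub (hf j)).mono ((ball_subset_ball (by linarith)).trans hyb)) ?_ hR2
      intro x hx
      rw [mem_closedBall, dist_eq_norm]
      calc ‖(f i - f j) x - (f i - f j) y‖ ≤ ‖(f i - f j) x‖ + ‖(f i - f j) y‖ := norm_sub_le _ _
        _ ≤ C * ‖u i - u j‖ + C * ‖u i - u j‖ :=
          add_le_add (hbound x hx) (hbound y (mem_ball_self hR2))
        _ = _ := by ring
    have hUC : UniformCauchySeqOn (fun i => fderiv ℂ (f i)) atTop (ball z R) := by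
      refine Metric.uniformCauchySeqOn_iff.2 fun ε hε => ?_
      obtain ⟨N, hN⟩ := Metric.cauchySeq_iff.1 hcau (ε * (R / 2) / (2 * C + 1)) (by positivity)
      refine ⟨N, fun i hi j hj y hy => ?_⟩
      have h2 := hN i hi j hj
      rw [dist_eq_norm] at h2 ⊢
      refine (hder i j y hy).trans_lt ?_
      rw [div_lt_iff₀ hR2]
      rw [lt_div_iff₀ (by positivity)] at h2
      nlinarith [norm_nonneg (u i - u j)]
    have hlimd : ∀ y, ∃ l, y ∈ ball z R → Tendsto (fun i => fderiv ℂ (f i) y) atTop (𝓝 l) := by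
      intro y
      by_cases hy : y ∈ ball z R
      · obtain ⟨l, hl⟩ := cauchySeq_tendsto_of_complete (hUC.cauchySeq hy)
        exact ⟨l, fun _ => hl⟩
      · exact ⟨0, fun h => absurd h hy⟩
    choose g' hg' using hlimd
    have hfin := hasFDerivAt_of_tendstoUniformlyOn (𝕜 := ℂ) isOpen_ball
      (hUC.tendstoUniformlyOn_of_tendsto hg') (fun i y hy => (hat i y hy).hasFDerivAt)
      (fun y hy => hg y (hball (hsub hy (mem_ball_self hR)))) (mem_ball_self hR)
    exact hfin.differentiableAt.differentiableWithinAt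
  · have hm : TendstoInMeasure μ (fun i => (u i : (Fin n → ℂ) → ℂ)) atTop U :=
      tendstoInMeasure_of_tendsto_Lp hlim
    obtain ⟨ns, hns, hae⟩ := hm.exists_seq_tendsto_ae
    have hall : ∀ᵐ w ∂μ, ∀ i, (u i : (Fin n → ℂ) → ℂ) w = f i w := ae_all_iff.2 huf
    filter_upwards [hae, hall, ae_restrict_mem Ω.isOpen.measurableSet] with w h1 h2 h3
    refine tendsto_nhds_unique h1 ?_
    simp only [h2]
    exact (hg w h3).comp hns.tendsto_atTop

instance bergmanSpace_completeSpace {n : ℕ} (Ω : TopologicalSpace.Opens (Fin n → ℂ)) :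
    CompleteSpace (bergmanSpace Ω) :=
  (bergmanSpace_isClosed Ω).completeSpace_coe

end

/-- The Bergman projection (the orthogonal projection onto the Bergman space), as a map `L²(Ω) → A²(Ω)`. -/
noncomputable def bergmanProjection {n : ℕ} (Ω : TopologicalSpace.Opens (Fin n → ℂ)) :
    Lp ℂ 2 (volume.restrict (Ω : Set (Fin n → ℂ))) →L[ℂ] bergmanSpace Ω :=
  (bergmanSpace Ω).orthogonalProjectionOnto

/-- The Toeplitz operator with symbol `φ ∈ L^∞(Ω)`, `T_φ f = P (φ f)` for `f ∈ A²(Ω)`. -/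
noncomputable def toeplitz {n : ℕ} (Ω : TopologicalSpace.Opens (Fin n → ℂ))
    (φ : Lp ℂ ∞ (volume.restrict (Ω : Set (Fin n → ℂ)))) :
    bergmanSpace Ω →L[ℂ] bergmanSpace Ω :=
  bergmanProjection Ω ∘L
    (ContinuousLinearMap.mul ℂ ℂ).holderL (volume.restrict (Ω : Set (Fin n → ℂ))) ∞ 2 2 φ ∘L
    (bergmanSpace Ω).subtypeL

/-- `Ω` is Reinhardt: it is invariant under rotation of each coordinate separately. -/
def IsReinhardt {n : ℕ} (Ω : Set (Fin n → ℂ)) : Prop :=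
  ∀ z ∈ Ω, ∀ θ : Fin n → ℝ, (fun j => Complex.exp (Complex.I * θ j) * z j) ∈ Ω

/-- `φ` is (separately) quasi-homogeneous on `Ω`: there are `f : [0, ∞)ⁿ → ℂ` and `k ∈ ℤⁿ` with
`φ (r₁ e^{iθ₁}, …, rₙ e^{iθₙ}) = f (r₁, …, rₙ) e^{i (k₁ θ₁ + ⋯ + kₙ θₙ)}` at all points of `Ω`. -/
def IsQuasiHomogeneousOn {n : ℕ} (φ : (Fin n → ℂ) → ℂ) (Ω : Set (Fin n → ℂ)) : Prop :=
  ∃ (f : (Fin n → ℝ≥0) → ℂ) (k : Fin n → ℤ), ∀ (r : Fin n → ℝ≥0) (θ : Fin n → ℝ),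
    (fun j => ((r j : ℝ) : ℂ) * Complex.exp (Complex.I * θ j)) ∈ Ω →
      φ (fun j => ((r j : ℝ) : ℂ) * Complex.exp (Complex.I * θ j)) =
        f r * Complex.exp (Complex.I * ∑ j, (k j : ℂ) * θ j)

/-! ### Identity theorem on connected open sets, and zero products of holomorphic functions. -/

section IdentityTheorem

open Metric Set Filter Topology

variable {E : Type*} [NormedAddCommGroup E] [NormedSpace ℂ E]

/-! Suppose that no symbol vanishes. By Stone–Weierstrass, each `φ j` has a nonzero moment `∫ φ j
z^(a j) conj(z^(b j))`. For a quasi-homogeneous symbol of weight `k`, rotation invariance forces `b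
j - a j = k`, and its Toeplitz operator sends `z^p` to a multiple of `z^(p + k)`
(`exists_toeplitz_bergmanMonomial_eq_smul`). The multiple is nonzero as soon as the corresponding
moment is.

Choose exponents `α 0, …, α m` with `α (j + 1) - α j = b j - a j`, all shifted by a free `δ`. All
operators but the last move `z^(α 0)` along this path up to scalars. For the last, arbitrary symbol
it suffices to pair with `z^(α m)`. Hence the vanishing of the operator product says that, for every
`δ`, the product over `j` of the moments of `φ j` at `(α j, α (j + 1))` is zero.

As functions of `δ`, these moments are, up to nonzero factors, values at `2 * (δ + e j)` of the
Laplace transform of `φ j z^(a j) conj(z^(b j))` in the variables `log |z i|`. These transforms are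
bounded and holomorphic on a product of right half-planes. A bounded holomorphic function there that
vanishes at all lattice points is zero: in one variable the zeros `1, 2, 3, …` violate the Blaschke
condition, since the harmonic series diverges (`eqOn_zero_of_bounded_of_forall_nat`). So one
transform vanishes identically, and letting its argument tend to `0` makes the chosen moment of that
`φ j` zero, a contradiction. -/

/-- The identity theorem for holomorphic functions on an open connected set of a normed space. -/
theorem DifferentiableOn.eqOn_zero_of_isPreconnected {U : Set E} (hU : IsOpen U)
    (hc : IsPreconnected U) {f : E → ℂ} (hf : DifferentiableOn ℂ f U) {p : E} (hp : p ∈ U)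
    (h0 : f =ᶠ[𝓝 p] 0) : EqOn f 0 U := by
  have hS : IsOpen {x | f =ᶠ[𝓝 x] 0} := isOpen_setOfPred_eventually_nhds
  refine fun x hx => Eventually.self_of_nhds (p := fun y => f y = 0)
    (hc.subset_of_closure_inter_subset hS ⟨p, hp, h0⟩ ?_ hx)
  rintro x ⟨hxS, hxU⟩
  obtain ⟨ε, hε, hball⟩ := Metric.isOpen_iff.1 hU x hxU
  -- With half the radius, the ball about `q` still contains `x` and stays inside `U`.
  obtain ⟨q, hqS, hqx⟩ := Metric.mem_closure_iff.1 hxS (ε / 2) (by positivity)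
  have hqU : ball q (ε / 2) ⊆ U := (ball_subset_ball' (by rw [dist_comm q x]; linarith)).trans hball
  have hxq : x ∈ ball q (ε / 2) := by rwa [mem_ball]
  filter_upwards [isOpen_ball.mem_nhds hxq] with y hy
  -- Restricting to the complex line through `q` and `y` reduces to one variable; the slice of the
  -- ball is convex, hence connected, and contains `0` and `1`.
  set W : Set ℂ := {t | t • (y - q) ∈ ball (0 : E) (ε / 2)} with hW
  have hWo : IsOpen W := isOpen_ball.preimage (by fun_prop)
  have hWc : Convex ℝ W := (convex_ball (0 : E) (ε / 2)).linear_preimage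
    ((LinearMap.toSpanSingleton ℂ E (y - q)).restrictScalars ℝ)
  have hmaps : ∀ t ∈ W, q + t • (y - q) ∈ U := fun t ht => hqU (by
    rw [mem_ball_iff_norm, add_sub_cancel_left]; simpa [hW] using ht)
  have hg : DifferentiableOn ℂ (fun t : ℂ => f (q + t • (y - q))) W := by
    refine hf.comp (by fun_prop) hmaps
  have hz : (fun t : ℂ => f (q + t • (y - q))) =ᶠ[𝓝 0] 0 := by
    have hcont : Tendsto (fun t : ℂ => q + t • (y - q)) (𝓝 0) (𝓝 q) := by
      have : Continuous (fun t : ℂ => q + t • (y - q)) := by fun_prop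
      simpa using this.tendsto 0
    exact hcont.eventually hqS
  have h1 : (1 : ℂ) ∈ W := by simpa [hW, dist_eq_norm] using hy
  have h0W : (0 : ℂ) ∈ W := by simpa [hW] using hε
  simpa using (hg.analyticOnNhd hWo).eqOn_zero_of_preconnected_of_eventuallyEq_zero
    hWc.isPreconnected h0W hz h1

theorem differentiableOn_finsetProd {ι : Type*} {s : Finset ι} {U : Set E} {f : ι → E → ℂ}
    (hf : ∀ i ∈ s, DifferentiableOn ℂ (f i) U) :
    DifferentiableOn ℂ (fun x => ∏ i ∈ s, f i x) U := by
  classical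
  induction s using Finset.induction_on with
  | empty => simp
  | insert i s hi ih =>
    simp only [Finset.prod_insert hi]
    exact (hf i (Finset.mem_insert_self _ _)).mul
      (ih fun j hj => hf j (Finset.mem_insert_of_mem hj))

/-- If a finite product of holomorphic functions vanishes identically on an open connected set,
then one of the factors does. -/
theorem exists_eqOn_zero_of_prod_eqOn_zero {ι : Type*} (s : Finset ι) {U : Set E} (hU : IsOpen U)
    (hc : IsPreconnected U) (hne : U.Nonempty) {f : ι → E → ℂ}
    (hf : ∀ i ∈ s, DifferentiableOn ℂ (f i) U) (h : ∀ x ∈ U, ∏ i ∈ s, f i x = 0) :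
    ∃ i ∈ s, EqOn (f i) 0 U := by
  classical
  by_contra! hcon
  -- Factors are added one at a time: near a point where the old product is nonzero, a vanishing new
  -- product would make the new factor vanish locally, hence on all of `U`.
  have key : ∀ t ⊆ s, ∃ p ∈ U, ∏ i ∈ t, f i p ≠ 0 := by
    intro t
    induction t using Finset.induction_on with
    | empty => exact fun _ => ⟨hne.some, hne.some_mem, by simp⟩
    | insert i t hi ih =>
      intro hts
      obtain ⟨p, hp, hpt⟩ := ih ((Finset.subset_insert _ _).trans hts)
      have his : i ∈ s := hts (Finset.mem_insert_self _ _)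
      have hd : DifferentiableOn ℂ (fun x => ∏ j ∈ t, f j x) U :=
        differentiableOn_finsetProd fun j hj => hf j (hts (Finset.mem_insert_of_mem hj))
      by_contra! hzero
      refine hcon i his ((hf i his).eqOn_zero_of_isPreconnected hU hc hp ?_)
      have hev : ∀ᶠ x in 𝓝 p, ∏ j ∈ t, f j x ≠ 0 :=
        (hd.continuousOn.continuousAt (hU.mem_nhds hp)).eventually_ne hpt
      filter_upwards [hev, hU.mem_nhds hp] with x hx hxU
      have := hzero x hxU
      rw [Finset.prod_insert hi] at this
      exact (mul_eq_zero.1 this).resolve_right hx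
  obtain ⟨p, hp, hne⟩ := key s subset_rfl
  exact hne (h p hp)

end IdentityTheorem

/-! ### Uniqueness for bounded holomorphic functions vanishing at positive integers. -/

section Carlson

open Metric Set Filter Topology Complex

theorem DiffContOnCl.dslope_halfPlane {F : ℂ → ℂ} (hF : DiffContOnCl ℂ F {z | 0 < z.re}) {a : ℝ}
    (ha : 0 < a) : DiffContOnCl ℂ (dslope F a) {z | 0 < z.re} := by
  have hopen : IsOpen {z : ℂ | 0 < z.re} := isOpen_lt continuous_const continuous_re
  have hmem : {z : ℂ | 0 < z.re} ∈ 𝓝 (a : ℂ) := hopen.mem_nhds (by simpa using ha)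
  refine ⟨(differentiableOn_dslope hmem).2 hF.differentiableOn, ?_⟩
  refine (continuousOn_dslope (mem_of_superset hmem subset_closure)).2 ⟨hF.continuousOn, ?_⟩
  exact hF.differentiableOn.differentiableAt hmem

/-- A zero of a bounded holomorphic function on the right half-plane can be divided out without
increasing the bound. -/
theorem exists_eq_mul_blaschke {F : ℂ → ℂ} {M : ℝ} (hF : DiffContOnCl ℂ F {z | 0 < z.re})
    (hM : ∀ z : ℂ, 0 ≤ z.re → ‖F z‖ ≤ M) {a : ℝ} (ha : 0 < a) (h0 : F a = 0) :
    ∃ g : ℂ → ℂ, DiffContOnCl ℂ g {z | 0 < z.re} ∧ (∀ z : ℂ, 0 ≤ z.re → ‖g z‖ ≤ M) ∧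
      ∀ z, F z * (z + a) = (z - a) * g z := by
  have hM0 : 0 ≤ M := (norm_nonneg _).trans (hM 0 le_rfl)
  have hid : ∀ z, F z * (z + a) = (z - a) * ((z + a) * dslope F a z) := by
    intro z
    have h1 := sub_smul_dslope F (a : ℂ) z
    rw [h0, sub_zero, smul_eq_mul] at h1
    rw [← h1]; ring
  have hg : DiffContOnCl ℂ (fun z => (z + a) * dslope F a z) {z | 0 < z.re} := by
    have h1 : DiffContOnCl ℂ (fun z : ℂ => z + a) {z | 0 < z.re} :=
      (differentiable_id.add_const (a : ℂ)).diffContOnCl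
    exact h1.smul (hF.dslope_halfPlane ha)
  -- Away from `a` the factor `|z + a| / |z - a|` is at most `3`, which is crude but enough for the
  -- growth conditions of Phragmén–Lindelöf.
  have hbig : ∀ z : ℂ, 0 ≤ z.re → 2 * a ≤ ‖z‖ → ‖(z + a) * dslope F a z‖ ≤ 3 * M := by
    intro z hz hza
    have h2 : ‖z‖ / 2 ≤ ‖z - a‖ := by
      have := norm_sub_norm_le z (a : ℂ)
      rw [norm_real, Real.norm_of_nonneg ha.le] at this
      linarith
    have h3 : ‖z + a‖ ≤ 3 / 2 * ‖z‖ := by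
      have := norm_add_le z (a : ℂ)
      rw [norm_real, Real.norm_of_nonneg ha.le] at this
      linarith
    have hpos : 0 < ‖z‖ / 2 := by linarith
    have h4 := congrArg norm (hid z)
    rw [norm_mul, norm_mul (z - a)] at h4
    have h5 : ‖z‖ / 2 * ‖(z + a) * dslope F a z‖ ≤ ‖z‖ / 2 * (3 * M) := by
      calc ‖z‖ / 2 * ‖(z + a) * dslope F a z‖ ≤ ‖z - a‖ * ‖(z + a) * dslope F a z‖ := by gcongr
        _ = ‖F z‖ * ‖z + a‖ := h4.symm
        _ ≤ M * (3 / 2 * ‖z‖) := by gcongr; exact hM z hz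
        _ = _ := by ring
    exact le_of_mul_le_mul_left h5 hpos
  refine ⟨_, hg, fun z hz => ?_, hid⟩
  -- The sharp constant `M` comes from the imaginary axis, where `|z + a| = |z - a|`.
  refine PhragmenLindelof.right_half_plane_of_bounded_on_real
    (f := fun z => (z + a) * dslope F a z) hg ⟨1, by norm_num, 0, ?_⟩
    ⟨3 * M, ?_⟩ (fun y => ?_) hz
  · refine Asymptotics.IsBigO.of_bound (3 * M) ?_
    have : ∀ᶠ z : ℂ in Bornology.cobounded ℂ, 2 * a ≤ ‖z‖ :=
      tendsto_norm_cobounded_atTop.eventually (eventually_ge_atTop _)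
    filter_upwards [this.filter_mono inf_le_left, mem_inf_of_right (mem_principal_self _)]
      with z h1 h2
    simpa using hbig z (le_of_lt h2) h1
  · rw [eventually_map]
    filter_upwards [eventually_ge_atTop (2 * a)] with x hx
    refine hbig x (by simpa using (by linarith : 0 ≤ x)) ?_
    rw [norm_real]
    exact hx.trans (le_abs_self x)
  · have h4 := congrArg norm (hid (y * I))
    rw [norm_mul, norm_mul ((y : ℂ) * I - a)] at h4
    have h5 : ‖(y : ℂ) * I + a‖ = ‖(y : ℂ) * I - a‖ := by
      rw [← sq_eq_sq₀ (norm_nonneg _) (norm_nonneg _), ← normSq_eq_norm_sq, ← normSq_eq_norm_sq]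
      simp [normSq_apply]
    have h6 : 0 < ‖(y : ℂ) * I - a‖ := by
      rw [norm_pos_iff]
      intro h
      have := congrArg re h
      simp at this
      exact ha.ne' this
    rw [h5, mul_comm] at h4
    have h7 := mul_left_cancel₀ h6.ne' h4
    rw [← h7]
    exact hM _ (by simp)

/-- The bound of a bounded holomorphic function on the right half-plane by a finite Blaschke product
formed from its positive real zeros. -/
theorem norm_mul_prod_le_prod (T : Finset ℝ) : ∀ {F : ℂ → ℂ} {M : ℝ},
    DiffContOnCl ℂ F {z | 0 < z.re} → (∀ z : ℂ, 0 ≤ z.re → ‖F z‖ ≤ M) →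
    (∀ a ∈ T, 0 < a ∧ F (a : ℂ) = 0) → ∀ z : ℂ, 0 ≤ z.re →
    ‖F z‖ * ∏ a ∈ T, ‖z + a‖ ≤ M * ∏ a ∈ T, ‖z - a‖ := by
  induction T using Finset.induction_on with
  | empty => intro F M _ hM _ z hz; simpa using hM z hz
  | insert a T haT ih =>
    intro F M hF hM hT z hz
    obtain ⟨ha, hFa⟩ := hT a (Finset.mem_insert_self _ _)
    obtain ⟨g, hg, hgM, hFg⟩ := exists_eq_mul_blaschke hF hM ha hFa
    have hgT : ∀ b ∈ T, 0 < b ∧ g (b : ℂ) = 0 := by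
      intro b hb
      obtain ⟨hb0, hFb⟩ := hT b (Finset.mem_insert_of_mem hb)
      refine ⟨hb0, ?_⟩
      have h1 := hFg b
      rw [hFb, zero_mul, eq_comm, mul_eq_zero] at h1
      refine h1.resolve_left fun h => haT ?_
      have : b = a := by exact_mod_cast sub_eq_zero.1 h
      exact this ▸ hb
    have h2 := ih hg hgM hgT z hz
    have h3 := congrArg norm (hFg z)
    rw [norm_mul, norm_mul] at h3
    rw [Finset.prod_insert haT, Finset.prod_insert haT, ← mul_assoc, h3]
    calc ‖z - a‖ * ‖g z‖ * ∏ x ∈ T, ‖z + x‖ = ‖z - a‖ * (‖g z‖ * ∏ x ∈ T, ‖z + x‖) := by ring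
      _ ≤ ‖z - a‖ * (M * ∏ x ∈ T, ‖z - x‖) := by gcongr
      _ = _ := by ring

/-- A bounded holomorphic function on the right half-plane that vanishes at the positive integers
vanishes identically. -/
theorem eqOn_zero_of_bounded_of_forall_nat {F : ℂ → ℂ} {M : ℝ}
    (hF : DifferentiableOn ℂ F {z | 0 < z.re}) (hM : ∀ z : ℂ, 0 < z.re → ‖F z‖ ≤ M)
    (h0 : ∀ k : ℕ, 1 ≤ k → F k = 0) : EqOn F 0 {z | 0 < z.re} := by
  have hopen : IsOpen {z : ℂ | 0 < z.re} := isOpen_lt continuous_const continuous_re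
  have hM0 : 0 ≤ M := (norm_nonneg _).trans (hM 1 (by simp))
  -- The shift by `1` gives continuity up to the boundary; the zeros `2, 3, …` of `F` become `1, 2,
  -- …`.
  have hF1 : DiffContOnCl ℂ (fun z => F (z + 1)) {z | 0 < z.re} := by
    refine DifferentiableOn.diffContOnCl (hF.comp (by fun_prop) ?_)
    intro z hz
    have hz' : 0 ≤ z.re := by
      have := closure_lt_subset_le (continuous_const (y := (0 : ℝ))) continuous_re hz
      simpa using this
    have : 0 < z.re + 1 := by linarith
    simpa using this
  have hsmall : ∀ x : ℝ, 0 < x → x < 1 → F (x + 1) = 0 := by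
    intro x hx hx1
    -- Each Blaschke factor `(s - x) / (s + x)` with `s = k + 1` is at most `1 - x / s ≤ exp (-x /
    -- s)`, because `0 < x < 1 ≤ s`.
    have hbound : ∀ N : ℕ, ‖F (x + 1)‖ ≤
        M * Real.exp (-x * ∑ k ∈ Finset.range N, 1 / ((k : ℝ) + 1)) := by
      intro N
      have h1 := norm_mul_prod_le_prod ((Finset.range N).image fun k : ℕ => (k : ℝ) + 1) hF1
        (M := M) (fun z hz => hM _ (by simp; linarith)) (by
          intro a ha
          obtain ⟨k, -, rfl⟩ := Finset.mem_image.1 ha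
          refine ⟨by positivity, ?_⟩
          have := h0 (k + 2) (by omega)
          push_cast at this ⊢
          rw [← this]; congr 1; ring) (x : ℂ) (by simpa using hx.le)
      rw [Finset.prod_image (by intro a _ b _ h; simpa using h),
        Finset.prod_image (by intro a _ b _ h; simpa using h)] at h1
      have h2 : ∀ k : ℕ, ‖(x : ℂ) + (((k : ℝ) + 1 : ℝ) : ℂ)‖ = x + (k + 1) := by
        intro k
        rw [← ofReal_add, norm_real, Real.norm_of_nonneg (by positivity)]
      have h3 : ∀ k : ℕ, ‖(x : ℂ) - (((k : ℝ) + 1 : ℝ) : ℂ)‖ ≤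
          (x + (k + 1)) * Real.exp (-x * (1 / ((k : ℝ) + 1))) := by
        intro k
        have hk : (0 : ℝ) ≤ k := by positivity
        rw [← ofReal_sub, norm_real, Real.norm_eq_abs, abs_sub_comm,
          abs_of_nonneg (by linarith)]
        have h4 := Real.add_one_le_exp (-x * (1 / ((k : ℝ) + 1)))
        refine le_trans ?_ (mul_le_mul_of_nonneg_left h4 (by positivity))
        have h5 : (x + (k + 1)) * (-x * (1 / ((k : ℝ) + 1)) + 1) =
            ((k : ℝ) + 1) - x * x / (k + 1) := by
          field_simp; ring
        rw [h5]
        have h6 : x * x / ((k : ℝ) + 1) ≤ x := by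
          rw [div_le_iff₀ (by positivity)]
          nlinarith
        linarith
      have hP : 0 < ∏ k ∈ Finset.range N, (x + ((k : ℝ) + 1)) :=
        Finset.prod_pos fun k _ => by positivity
      simp only [h2] at h1
      have h7 : ∏ k ∈ Finset.range N, ‖(x : ℂ) - (((k : ℝ) + 1 : ℝ) : ℂ)‖ ≤
          (∏ k ∈ Finset.range N, (x + ((k : ℝ) + 1))) *
            Real.exp (-x * ∑ k ∈ Finset.range N, 1 / ((k : ℝ) + 1)) := by
        rw [Finset.mul_sum, Real.exp_sum, ← Finset.prod_mul_distrib]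
        exact Finset.prod_le_prod (fun _ _ => norm_nonneg _) fun k _ => h3 k
      refine le_of_mul_le_mul_right ?_ hP
      refine h1.trans ((mul_le_mul_of_nonneg_left h7 hM0).trans (le_of_eq (by ring)))
    have hlim : Tendsto (fun N : ℕ =>
        M * Real.exp (-x * ∑ k ∈ Finset.range N, 1 / ((k : ℝ) + 1))) atTop (𝓝 (M * 0)) := by
      refine (Real.tendsto_exp_atBot.comp ?_).const_mul M
      exact Real.tendsto_sum_range_one_div_nat_succ_atTop.const_mul_atTop_of_neg (by linarith)
    rw [mul_zero] at hlim
    exact norm_le_zero_iff.1 (ge_of_tendsto' hlim hbound)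
  have hconv : Convex ℝ {z : ℂ | 0 < z.re} := convex_halfSpace_re_gt 0
  refine (hF.analyticOnNhd hopen).eqOn_zero_of_preconnected_of_frequently_eq_zero
    hconv.isPreconnected (z₀ := 1) (by simp) ?_
  -- The zeros in `(1, 2)` accumulate at the interior point `1`; halving keeps the offset below `1`
  -- when `N = 0`.
  have ht : Tendsto (fun N : ℕ => (((1 / ((N : ℝ) + 1) : ℝ) : ℂ) / 2 + 1)) atTop (𝓝[≠] 1) := by
    refine tendsto_nhdsWithin_iff.2 ⟨?_, Eventually.of_forall fun N => ?_⟩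
    · have h1 : Tendsto (fun N : ℕ => ((1 / ((N : ℝ) + 1) : ℝ) : ℂ)) atTop (𝓝 ((0 : ℝ) : ℂ)) :=
        (continuous_ofReal.tendsto 0).comp tendsto_one_div_add_atTop_nhds_zero_nat
      simpa using (h1.div_const 2).add_const 1
    · have : (1 / ((N : ℝ) + 1)) ≠ 0 := by positivity
      simp only [mem_compl_iff, mem_singleton_iff, add_eq_right, div_eq_zero_iff, ofReal_eq_zero,
        this, false_or]
      norm_num
  refine ht.frequently (Frequently.of_forall fun N => ?_)
  have h1 : 0 < 1 / ((N : ℝ) + 1) := by positivity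
  have h2 : 1 / ((N : ℝ) + 1) ≤ 1 := by
    rw [div_le_one (by positivity)]
    have : (0 : ℝ) ≤ N := by positivity
    linarith
  have := hsmall (1 / ((N : ℝ) + 1) / 2) (by positivity) (by linarith)
  push_cast at this ⊢
  exact this

/-- A bounded holomorphic function on a product of right half-planes that vanishes at the lattice
points with positive coordinates vanishes identically. -/
theorem eqOn_zero_of_bounded_of_forall_lattice {n : ℕ} {H : (Fin n → ℂ) → ℂ} {M : ℝ}
    (hH : DifferentiableOn ℂ H {ζ | ∀ i, 0 < (ζ i).re})
    (hM : ∀ ζ : Fin n → ℂ, (∀ i, 0 < (ζ i).re) → ‖H ζ‖ ≤ M)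
    (h0 : ∀ δ : Fin n → ℕ, (∀ i, 1 ≤ δ i) → H (fun i => δ i) = 0) :
    EqOn H 0 {ζ | ∀ i, 0 < (ζ i).re} := by
  classical
  -- `A` collects the coordinates that are free; the others are positive integers. The one-variable
  -- result frees one coordinate at a time.
  have key : ∀ A : Finset (Fin n), ∀ ζ : Fin n → ℂ, (∀ i, 0 < (ζ i).re) →
      (∀ i ∉ A, ∃ k : ℕ, 1 ≤ k ∧ ζ i = k) → H ζ = 0 := by
    intro A
    induction A using Finset.induction_on with
    | empty =>
      intro ζ _ hζ
      choose δ hδ1 hδ using fun i => hζ i (by simp)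
      rw [show ζ = fun i => (δ i : ℂ) from funext hδ]
      exact h0 δ hδ1
    | insert j A hj ih =>
      intro ζ hpos hζ
      have hupd : ∀ s : ℂ, 0 < s.re → ∀ i, 0 < (Function.update ζ j s i).re := by
        intro s hs i
        rcases eq_or_ne i j with rfl | hij
        · simpa using hs
        · simpa [hij] using hpos i
      have h1 := eqOn_zero_of_bounded_of_forall_nat (F := fun s => H (Function.update ζ j s))
        (M := M) (hH.comp
          (fun s _ => (hasDerivAt_update ζ j s).differentiableAt.differentiableWithinAt) hupd)
        (fun s hs => hM _ (hupd s hs)) ?_ (hpos j)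
      · simpa using h1
      · intro k hk
        refine ih _ (hupd k (by simp; omega)) fun i hi => ?_
        rcases eq_or_ne i j with rfl | hij
        · exact ⟨k, hk, by simp⟩
        · simpa [hij] using hζ i (by simp [hij, hi])
  exact fun ζ hζ => key Finset.univ ζ hζ (by simp)

end Carlson

/-! ### Laplace transforms on a product of right half-planes. -/

section MellinTransform

open Metric Set Filter Topology Complex

variable {n : ℕ}

theorem norm_cexp_sum_mul_le_one {α : Type*} {ℓ : Fin n → α → ℝ} (hℓ : ∀ i x, ℓ i x ≤ 0)
    {ζ : Fin n → ℂ} (hζ : ∀ i, 0 ≤ (ζ i).re) (x : α) : ‖cexp (∑ i, ζ i * ℓ i x)‖ ≤ 1 := by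
  rw [norm_exp, Real.exp_le_one_iff, re_sum]
  refine Finset.sum_nonpos fun i _ => ?_
  rw [re_mul_ofReal]
  exact mul_nonpos_of_nonneg_of_nonpos (hζ i) (hℓ i x)

variable {α : Type*} [MeasurableSpace α]

/-- The Laplace transform of `g` with respect to the exponents `ℓ`; for `ℓ i = log |z i|` this is
the multivariate Mellin transform. -/
noncomputable def laplaceTransform (μ : Measure α) (ℓ : Fin n → α → ℝ) (g : α → ℂ)
    (ζ : Fin n → ℂ) : ℂ :=
  ∫ x, g x * cexp (∑ i, ζ i * ℓ i x) ∂μ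

variable {μ : Measure α} {ℓ : Fin n → α → ℝ} {g : α → ℂ}

theorem aestronglyMeasurable_mul_cexp (hg : Integrable g μ) (hm : ∀ i, Measurable (ℓ i))
    (ζ : Fin n → ℂ) : AEStronglyMeasurable (fun x => g x * cexp (∑ i, ζ i * ℓ i x)) μ := by
  refine hg.aestronglyMeasurable.mul (Measurable.aestronglyMeasurable ?_)
  fun_prop

/-- Nonpositive exponents make the kernel a contraction. The bound is uniform in `ζ`, as the lattice
uniqueness theorem requires. -/
theorem norm_laplaceTransform_le (hg : Integrable g μ) (hℓ : ∀ i x, ℓ i x ≤ 0) {ζ : Fin n → ℂ}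
    (hζ : ∀ i, 0 ≤ (ζ i).re) : ‖laplaceTransform μ ℓ g ζ‖ ≤ ∫ x, ‖g x‖ ∂μ := by
  refine norm_integral_le_of_norm_le hg.norm (Eventually.of_forall fun x => ?_)
  rw [norm_mul]
  exact mul_le_of_le_one_right (norm_nonneg _) (norm_cexp_sum_mul_le_one hℓ hζ x)

theorem isOpen_pi_re_pos : IsOpen {ζ : Fin n → ℂ | ∀ i, 0 < (ζ i).re} := by
  rw [ofPred_forall]
  exact isOpen_iInter_of_finite fun i =>
    isOpen_lt continuous_const (continuous_re.comp (continuous_apply i))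

theorem convex_pi_re_pos : Convex ℝ {ζ : Fin n → ℂ | ∀ i, 0 < (ζ i).re} := by
  rw [ofPred_forall]
  exact convex_iInter fun i => (convex_halfSpace_re_gt 0).linear_preimage
    (LinearMap.proj (R := ℝ) (φ := fun _ : Fin n => ℂ) i)

theorem differentiableOn_laplaceTransform (hg : Integrable g μ) (hm : ∀ i, Measurable (ℓ i))
    (hℓ : ∀ i x, ℓ i x ≤ 0) :
    DifferentiableOn ℂ (laplaceTransform μ ℓ g) {ζ | ∀ i, 0 < (ζ i).re} := by
  intro ζ₀ hζ₀
  obtain ⟨ε', hε', hball⟩ := Metric.isOpen_iff.1 isOpen_pi_re_pos ζ₀ hζ₀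
  set ε := ε' / 2
  have hε : 0 < ε := by positivity
  -- Subtracting `ε` from every coordinate moves a point by at most `ε` in the sup norm, so it
  -- remains in the ball of radius `2 * ε`, where real parts are positive.
  have hre : ∀ ζ ∈ ball ζ₀ ε, ∀ i, ε ≤ (ζ i).re := by
    intro ζ hζ i
    have h1 : ζ - (fun _ => (ε : ℂ)) ∈ ball ζ₀ ε' := by
      rw [mem_ball_iff_norm] at hζ ⊢
      have h2 : ‖(fun _ : Fin n => (ε : ℂ))‖ ≤ ε := by
        refine (pi_norm_le_iff_of_nonneg hε.le).2 fun _ => ?_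
        rw [norm_real, Real.norm_of_nonneg hε.le]
      calc ‖ζ - (fun _ => (ε : ℂ)) - ζ₀‖ = ‖(ζ - ζ₀) - (fun _ => (ε : ℂ))‖ := by congr 1; abel
        _ ≤ ‖ζ - ζ₀‖ + ‖(fun _ : Fin n => (ε : ℂ))‖ := norm_sub_le _ _
        _ < ε' := by simp only [ε] at *; linarith
    have h3 := hball h1 i
    simp only [Pi.sub_apply, sub_re, ofReal_re] at h3
    linarith
  set F' : (Fin n → ℂ) → α → (Fin n → ℂ) →L[ℂ] ℂ := fun ζ x =>
    (g x * cexp (∑ i, ζ i * ℓ i x)) •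
      ∑ i, (ℓ i x : ℂ) • ContinuousLinearMap.proj (R := ℂ) (φ := fun _ : Fin n => ℂ) i
  have hproj : ∀ i, ‖ContinuousLinearMap.proj (R := ℂ) (φ := fun _ : Fin n => ℂ) i‖ ≤ 1 := fun i =>
    ContinuousLinearMap.opNorm_le_bound _ zero_le_one fun v => by simpa using norm_le_pi_norm v i
  -- Differentiation brings down an unbounded `ℓ i`; the decay absorbs it through `t * exp (-ε * t)
  -- ≤ 1 / ε` for `t ≥ 0`.
  have hterm : ∀ ζ ∈ ball ζ₀ ε, ∀ x i, ‖cexp (∑ j, ζ j * ℓ j x)‖ * ‖(ℓ i x : ℂ)‖ ≤ 1 / ε := by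
    intro ζ hζ x i
    have h1 : (∑ j, ζ j * ℓ j x).re ≤ ε * ℓ i x := by
      rw [re_sum, ← Finset.add_sum_erase _ _ (Finset.mem_univ i)]
      have h2 : ∑ j ∈ Finset.univ.erase i, (ζ j * ℓ j x).re ≤ 0 := by
        refine Finset.sum_nonpos fun j _ => ?_
        rw [re_mul_ofReal]
        exact mul_nonpos_of_nonneg_of_nonpos (hε.le.trans (hre ζ hζ j)) (hℓ j x)
      have h3 : (ζ i * ℓ i x).re ≤ ε * ℓ i x := by
        rw [re_mul_ofReal]
        exact mul_le_mul_of_nonpos_right (hre ζ hζ i) (hℓ i x)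
      linarith
    rw [norm_exp, norm_real, Real.norm_of_nonpos (hℓ i x)]
    have h4 := Real.add_one_le_exp (ε * -ℓ i x)
    have h5 : 0 ≤ -ℓ i x := neg_nonneg.2 (hℓ i x)
    calc Real.exp (∑ j, ζ j * ℓ j x).re * -ℓ i x
        ≤ Real.exp (ε * ℓ i x) * -ℓ i x := by gcongr
      _ ≤ Real.exp (ε * ℓ i x) * (Real.exp (ε * -ℓ i x) / ε) := by
          gcongr
          rw [le_div_iff₀ hε]
          linarith
      _ = 1 / ε := by
          rw [← mul_div_assoc, ← Real.exp_add]
          simp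
  refine (hasFDerivAt_integral_of_dominated_of_fderiv_le (F' := F')
    (bound := fun x => ‖g x‖ * (n * (1 / ε))) (ball_mem_nhds ζ₀ hε)
    (Eventually.of_forall fun ζ => aestronglyMeasurable_mul_cexp hg hm ζ) ?_ ?_ ?_
    (hg.norm.mul_const _) ?_).differentiableAt.differentiableWithinAt
  · exact hg.mono (aestronglyMeasurable_mul_cexp hg hm ζ₀) (Eventually.of_forall fun x => by
      rw [norm_mul]
      exact mul_le_of_le_one_right (norm_nonneg _)
        (norm_cexp_sum_mul_le_one hℓ (fun i => (hζ₀ i).le) x))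
  · refine (aestronglyMeasurable_mul_cexp hg hm ζ₀).smul ?_
    refine Finset.aestronglyMeasurable_fun_sum _ fun i _ => ?_
    exact (measurable_ofReal.comp (hm i)).aestronglyMeasurable.smul_const _
  · refine Eventually.of_forall fun x ζ hζ => ?_
    simp only [F']
    rw [norm_smul, norm_mul, mul_assoc]
    refine mul_le_mul_of_nonneg_left ?_ (norm_nonneg _)
    calc ‖cexp (∑ i, ζ i * ℓ i x)‖ * ‖∑ i, (ℓ i x : ℂ) •
          ContinuousLinearMap.proj (R := ℂ) (φ := fun _ : Fin n => ℂ) i‖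
        ≤ ‖cexp (∑ i, ζ i * ℓ i x)‖ * ∑ i, ‖(ℓ i x : ℂ)‖ := by
          gcongr
          refine (norm_sum_le _ _).trans (Finset.sum_le_sum fun i _ => ?_)
          rw [norm_smul]
          exact mul_le_of_le_one_right (norm_nonneg _) (hproj i)
      _ = ∑ i, ‖cexp (∑ j, ζ j * ℓ j x)‖ * ‖(ℓ i x : ℂ)‖ := Finset.mul_sum _ _ _
      _ ≤ ∑ _i : Fin n, 1 / ε := Finset.sum_le_sum fun i _ => hterm ζ hζ x i
      _ = n * (1 / ε) := by simp
  · refine Eventually.of_forall fun x ζ _ => ?_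
    have h1 : HasFDerivAt (fun ζ : Fin n → ℂ => ∑ i, ζ i * (ℓ i x : ℂ))
        (∑ i, (ℓ i x : ℂ) • ContinuousLinearMap.proj (R := ℂ) (φ := fun _ : Fin n => ℂ) i) ζ :=
      HasFDerivAt.fun_sum fun i _ => (hasFDerivAt_apply i ζ).mul_const _
    have h2 := (h1.cexp).const_mul (g x)
    simpa only [F', smul_smul] using h2

/-- The Laplace transform is continuous at the origin from inside the orthant. -/
theorem laplaceTransform_zero_of_eqOn_zero (hg : Integrable g μ) (hm : ∀ i, Measurable (ℓ i))
    (hℓ : ∀ i x, ℓ i x ≤ 0) (h : EqOn (laplaceTransform μ ℓ g) 0 {ζ | ∀ i, 0 < (ζ i).re}) :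
    ∫ x, g x ∂μ = 0 := by
  have hlim : Tendsto (fun k : ℕ => laplaceTransform μ ℓ g fun _ => ((1 / ((k : ℝ) + 1) : ℝ) : ℂ))
      atTop (𝓝 (∫ x, g x ∂μ)) := by
    refine tendsto_integral_of_dominated_convergence (fun x => ‖g x‖)
      (fun k => aestronglyMeasurable_mul_cexp hg hm _) hg.norm (fun k => ?_) ?_
    · refine Eventually.of_forall fun x => ?_
      rw [norm_mul]
      refine mul_le_of_le_one_right (norm_nonneg _) (norm_cexp_sum_mul_le_one hℓ (fun i => ?_) x)
      rw [ofReal_re]; positivity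
    · refine Eventually.of_forall fun x => ?_
      have h0 : Tendsto (fun k : ℕ => ((1 / ((k : ℝ) + 1) : ℝ) : ℂ)) atTop (𝓝 ((0 : ℝ) : ℂ)) :=
        (continuous_ofReal.tendsto 0).comp tendsto_one_div_add_atTop_nhds_zero_nat
      have hc : Continuous fun t : ℂ => g x * cexp (∑ i, t * ℓ i x) := by fun_prop
      simpa [Function.comp_def] using (hc.tendsto _).comp h0
  refine tendsto_nhds_unique hlim ?_
  refine tendsto_const_nhds.congr fun k => (h fun i => ?_).symm
  rw [ofReal_re]; positivity

/-- If a product of translated and dilated Laplace transforms vanishes at all lattice points with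
positive coordinates, then one of the functions has integral zero. -/
theorem exists_integral_eq_zero_of_prod_laplaceTransform_eq_zero {ι : Type*} [Fintype ι]
    {g : ι → α → ℂ} (hg : ∀ j, Integrable (g j) μ) (hm : ∀ i, Measurable (ℓ i))
    (hℓ : ∀ i x, ℓ i x ≤ 0) (e : ι → Fin n → ℕ)
    (h : ∀ δ : Fin n → ℕ, (∀ i, 1 ≤ δ i) →
      ∏ j, laplaceTransform μ ℓ (g j) (fun i => 2 * (δ i + e j i)) = 0) :
    ∃ j, ∫ x, g j x ∂μ = 0 := by
  set U : Set (Fin n → ℂ) := {ζ | ∀ i, 0 < (ζ i).re} with hU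
  have hmaps : ∀ j, ∀ ζ ∈ U, (fun i => 2 * (ζ i + e j i)) ∈ U := by
    intro j ζ hζ i
    have := hζ i
    have h2 : (0 : ℝ) ≤ e j i := by positivity
    simp only [mul_re, re_ofNat, im_ofNat, zero_mul, sub_zero, add_re, natCast_re]
    linarith
  have hd : ∀ j, DifferentiableOn ℂ
      (fun ζ => laplaceTransform μ ℓ (g j) (fun i => 2 * (ζ i + e j i))) U := fun j =>
    (differentiableOn_laplaceTransform (hg j) hm hℓ).comp
      (Differentiable.differentiableOn (by fun_prop)) (hmaps j)
  have hzero := eqOn_zero_of_bounded_of_forall_lattice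
    (H := fun ζ => ∏ j, laplaceTransform μ ℓ (g j) (fun i => 2 * (ζ i + e j i)))
    (M := ∏ j, ∫ x, ‖g j x‖ ∂μ) (differentiableOn_finsetProd fun j _ => hd j)
    (fun ζ hζ => by
      rw [norm_prod]
      exact Finset.prod_le_prod (fun _ _ => norm_nonneg _) fun j _ =>
        norm_laplaceTransform_le (hg j) hℓ fun i => (hmaps j ζ hζ i).le) h
  have h1U : (fun _ => 1 : Fin n → ℂ) ∈ U := fun i => by simp
  obtain ⟨j, -, hj⟩ := exists_eqOn_zero_of_prod_eqOn_zero Finset.univ isOpen_pi_re_pos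
    convex_pi_re_pos.isPreconnected ⟨_, h1U⟩ (fun j _ => hd j) hzero
  refine ⟨j, laplaceTransform_zero_of_eqOn_zero (hg j) hm hℓ ?_⟩
  refine (differentiableOn_laplaceTransform (hg j) hm hℓ).eqOn_zero_of_isPreconnected
    isOpen_pi_re_pos convex_pi_re_pos.isPreconnected (hmaps j _ h1U) ?_
  -- This inverts the substitution `ζ ↦ 2 * (ζ + e j)`, turning vanishing of the composite near `(1,
  -- …, 1)` into vanishing of the transform near the image point.
  have hcont : Tendsto (fun ζ : Fin n → ℂ => fun i => ζ i / 2 - (e j i : ℂ))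
      (𝓝 fun i => 2 * (1 + (e j i : ℂ))) (𝓝 fun _ => 1) := by
    have hc : Continuous (fun ζ : Fin n → ℂ => fun i => ζ i / 2 - (e j i : ℂ)) := by fun_prop
    have := hc.tendsto (fun i => 2 * (1 + (e j i : ℂ)))
    simpa using this
  filter_upwards [hcont (isOpen_pi_re_pos.mem_nhds h1U)] with ζ hζ
  have h2 := hj hζ
  simp only [sub_add_cancel] at h2
  refine Eq.trans ?_ h2
  congr 1
  funext i
  ring

end MellinTransform

/-! ### Moments determine an integrable function on a bounded open set. -/

section Moments

open Metric Set Filter Topology ComplexConjugate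

variable {n : ℕ}

/-- The monomial `z ↦ z₁ ^ a₁ ⋯ zₙ ^ aₙ`. -/
def monomialFun (a : Fin n → ℕ) (z : Fin n → ℂ) : ℂ := ∏ i, z i ^ a i

theorem monomialFun_add (a b : Fin n → ℕ) (z : Fin n → ℂ) :
    monomialFun (a + b) z = monomialFun a z * monomialFun b z := by
  simp [monomialFun, pow_add, Finset.prod_mul_distrib]

@[simp]
theorem monomialFun_zero (z : Fin n → ℂ) : monomialFun 0 z = 1 := by simp [monomialFun]

theorem monomialFun_single (i : Fin n) (z : Fin n → ℂ) :
    monomialFun (Pi.single i 1) z = z i := by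
  rw [monomialFun, Finset.prod_eq_single i (fun j _ hj => by simp [hj]) (by simp)]
  simp

@[fun_prop]
theorem differentiable_monomialFun (a : Fin n → ℕ) : Differentiable ℂ (monomialFun a) := by
  rw [← differentiableOn_univ]
  exact differentiableOn_finsetProd fun i _ =>
    Differentiable.differentiableOn (by fun_prop)

@[fun_prop]
theorem continuous_monomialFun (a : Fin n → ℕ) : Continuous (monomialFun a) :=
  (differentiable_monomialFun a).continuous

/-- An integrable function on a compact set all of whose moments vanish is orthogonal to all
continuous functions. -/
theorem integral_mul_continuousMap_eq_zero_of_moments {K : Set (Fin n → ℂ)} [CompactSpace K]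
    {ν : Measure K} {f : K → ℂ} (hf : Integrable f ν)
    (h : ∀ a b : Fin n → ℕ, ∫ z, f z * (monomialFun a z * conj (monomialFun b z)) ∂ν = 0)
    (g : C(K, ℂ)) : ∫ z, f z * g z ∂ν = 0 := by
  have hint : ∀ {f : K → ℂ}, Integrable f ν → ∀ q : C(K, ℂ), Integrable (fun z => f z * q z) ν :=
    fun {f} hf q => hf.mul_bdd (c := ‖q‖) q.continuous.aestronglyMeasurable
      (Eventually.of_forall fun z => q.norm_coe_le_norm z)
  -- This class is stable under conjugation and under multiplication by coordinates. Quantifying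
  -- over the whole class, not one `f`, lets the induction over the star subalgebra handle products
  -- and stars.
  let null : (K → ℂ) → Prop := fun f => Integrable f ν ∧
    ∀ a b : Fin n → ℕ, ∫ z, f z * (monomialFun a z * conj (monomialFun b z)) ∂ν = 0
  have hmono : ∀ {f : K → ℂ}, Integrable f ν → ∀ a b : Fin n → ℕ,
      Integrable (fun z : K => f z * (monomialFun a z * conj (monomialFun b z))) ν :=
    fun hf a b => hint hf ⟨fun z : K => monomialFun a z * conj (monomialFun b z), by fun_prop⟩
  have hconj : ∀ {f : K → ℂ}, null f → null fun z => conj (f z) := by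
    rintro f ⟨hf, h⟩
    refine ⟨LinearIsometryEquiv.integrable_comp_iff (Complex.conjLIE) |>.2 hf, fun a b => ?_⟩
    rw [← map_zero (starRingEnd ℂ), ← h b a, ← integral_conj]
    refine integral_congr_ae (Eventually.of_forall fun z => ?_)
    simp only [map_mul, Complex.conj_conj]
    ring
  set A : StarSubalgebra ℂ C(K, ℂ) := StarAlgebra.adjoin ℂ
    (range fun i : Fin n => (⟨fun z : K => (z : Fin n → ℂ) i,
      (continuous_apply i).comp continuous_subtype_val⟩ : C(K, ℂ)))
  have hA : A.topologicalClosure = ⊤ := by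
    refine ContinuousMap.starSubalgebra_topologicalClosure_eq_top_of_separatesPoints A ?_
    intro x y hxy
    obtain ⟨i, hi⟩ : ∃ i, (x : Fin n → ℂ) i ≠ (y : Fin n → ℂ) i := by
      by_contra! hcon
      exact hxy (Subtype.ext (funext hcon))
    exact ⟨_, ⟨_, StarAlgebra.subset_adjoin ℂ _ ⟨i, rfl⟩, rfl⟩, hi⟩
  have hmul : ∀ q ∈ A, ∀ f, null f → null fun z => f z * q z := by
    intro q hq
    induction hq using StarAlgebra.adjoin_induction with
    | mem q hq =>
      obtain ⟨i, rfl⟩ := hq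
      rintro f ⟨hf, h⟩
      refine ⟨hint hf _, fun a b => ?_⟩
      rw [← h (Pi.single i 1 + a) b]
      refine integral_congr_ae (Eventually.of_forall fun z => ?_)
      simp only [monomialFun_add, monomialFun_single, ContinuousMap.coe_mk]
      ring
    | algebraMap c =>
      rintro f ⟨hf, h⟩
      refine ⟨hint hf _, fun a b => ?_⟩
      rw [← mul_zero c, ← h a b, ← integral_const_mul]
      refine integral_congr_ae (Eventually.of_forall fun z => ?_)
      change f z * c * _ = c * _
      ring
    | add p q _ _ hp hq =>
      intro f hf
      obtain ⟨h1, h1'⟩ := hp f hf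
      obtain ⟨h2, h2'⟩ := hq f hf
      refine ⟨hint hf.1 _, fun a b => ?_⟩
      have h3 := integral_add (hmono h1 a b) (hmono h2 a b)
      rw [h1' a b, h2' a b, add_zero] at h3
      rw [← h3]
      refine integral_congr_ae (Eventually.of_forall fun z => ?_)
      simp only [ContinuousMap.add_apply]
      ring
    | mul p q _ _ hp hq =>
      intro f hf
      simpa only [ContinuousMap.mul_apply, mul_assoc] using hq _ (hp f hf)
    | star q _ hq =>
      intro f hf
      have := hconj (hq _ (hconj hf))
      simp only [map_mul, Complex.conj_conj] at this
      exact this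
  have hg : g ∈ closure (A : Set C(K, ℂ)) := by
    have : g ∈ A.topologicalClosure := hA ▸ trivial
    exact this
  refine norm_le_zero_iff.1 (le_of_forall_pos_le_add fun ε hε => ?_)
  set C := ∫ z, ‖f z‖ ∂ν
  have hC : 0 ≤ C := integral_nonneg fun _ => norm_nonneg _
  obtain ⟨q, hqA, hq⟩ := Metric.mem_closure_iff.1 hg (ε / (C + 1)) (by positivity)
  have h0 : ∫ z, f z * q z ∂ν = 0 := by
    simpa using (hmul q hqA f ⟨hf, h⟩).2 0 0
  have h1 : ∫ z, f z * g z ∂ν = ∫ z, f z * (g - q) z ∂ν := by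
    rw [← sub_zero (∫ z, f z * g z ∂ν), ← h0, ← integral_sub (hint hf g) (hint hf q)]
    simp only [ContinuousMap.sub_apply, mul_sub]
  rw [h1]
  rw [dist_eq_norm] at hq
  calc ‖∫ z, f z * (g - q) z ∂ν‖ ≤ ∫ z, ‖f z‖ * ‖g - q‖ ∂ν := by
        refine norm_integral_le_of_norm_le (hf.norm.mul_const _) (Eventually.of_forall fun z => ?_)
        rw [norm_mul]
        gcongr
        exact (g - q).norm_coe_le_norm z
    _ = C * ‖g - q‖ := integral_mul_const _ _
    _ ≤ (C + 1) * (ε / (C + 1)) := by gcongr; linarith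
    _ = 0 + ε := by field_simp; ring

/-- An integrable function on a bounded open set all of whose moments vanish is zero. -/
theorem ae_eq_zero_of_moments {Ω : Set (Fin n → ℂ)} (hΩ : IsOpen Ω) (hb : Bornology.IsBounded Ω)
    {f : (Fin n → ℂ) → ℂ} (hf : IntegrableOn f Ω)
    (h : ∀ a b : Fin n → ℕ, ∫ z in Ω, f z * (monomialFun a z * conj (monomialFun b z)) = 0) :
    f =ᵐ[volume.restrict Ω] 0 := by
  -- Stone–Weierstrass needs a compact space, so the measure on `Ω` is viewed on a closed ball
  -- containing it.
  obtain ⟨R, hR⟩ := hb.subset_closedBall 0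
  set K := closedBall (0 : Fin n → ℂ) R
  have hK : MeasurableSet K := isClosed_closedBall.measurableSet
  have : CompactSpace K := isCompact_iff_compactSpace.1 (isCompact_closedBall _ _)
  have hres : (volume.restrict Ω).restrict K = volume.restrict Ω := by
    rw [Measure.restrict_restrict hK, inter_eq_right.2 hR]
  have hsub : ∀ F : (Fin n → ℂ) → ℂ,
      ∫ z : K, F z ∂((volume.restrict Ω).comap Subtype.val) = ∫ z in Ω, F z := by
    intro F
    rw [integral_subtype_comap hK, hres]
  have hfK : Integrable (fun z : K => f z) ((volume.restrict Ω).comap Subtype.val) := by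
    have h1 : IntegrableOn f K (volume.restrict Ω) := by rwa [IntegrableOn, hres]
    exact (integrableOn_iff_comap_subtypeVal hK).1 h1
  rw [EventuallyEq, ae_restrict_iff' hΩ.measurableSet]
  refine hΩ.ae_eq_zero_of_integral_contDiff_smul_eq_zero hf.locallyIntegrableOn ?_
  intro g hg _ hgs
  have hz : ∀ x, x ∉ Ω → g x • f x = 0 := fun x hx => by
    rw [image_eq_zero_of_notMem_tsupport fun h => hx (hgs h), zero_smul]
  rw [← setIntegral_eq_integral_of_forall_compl_eq_zero hz, ← hsub]
  have hgc := hg.continuous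
  have := integral_mul_continuousMap_eq_zero_of_moments hfK (fun a b => by
    rw [hsub fun z => f z * (monomialFun a z * conj (monomialFun b z))]; exact h a b)
    ⟨fun z : K => (g z : ℂ), by fun_prop⟩
  rw [← this]
  refine integral_congr_ae (Eventually.of_forall fun z => ?_)
  simp [Complex.real_smul, mul_comm]

end Moments

/-! ### The torus action, weights, and holomorphic functions of monomial weight. -/

section Rotation

open Metric Set Filter Topology ComplexConjugate

variable {n : ℕ}

/-- The rotation of the `j`-th coordinate by the angle `θ j`, for each `j`. -/
noncomputable def torusRotation (θ : Fin n → ℝ) (z : Fin n → ℂ) : Fin n → ℂ :=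
  fun j => Complex.exp (Complex.I * θ j) * z j

/-- The character of the torus with exponents `k`. -/
noncomputable def torusCharacter (k : Fin n → ℤ) (θ : Fin n → ℝ) : ℂ :=
  Complex.exp (Complex.I * ∑ j, (k j : ℂ) * θ j)

theorem torusCharacter_add (k l : Fin n → ℤ) (θ : Fin n → ℝ) :
    torusCharacter (k + l) θ = torusCharacter k θ * torusCharacter l θ := by
  simp only [torusCharacter, ← Complex.exp_add, ← mul_add, ← Finset.sum_add_distrib, Pi.add_apply,
    Int.cast_add, add_mul]

theorem torusCharacter_neg (k : Fin n → ℤ) (θ : Fin n → ℝ) :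
    torusCharacter (-k) θ = conj (torusCharacter k θ) := by
  simp [torusCharacter, ← Complex.exp_conj]

theorem torusCharacter_ne_zero (k : Fin n → ℤ) (θ : Fin n → ℝ) : torusCharacter k θ ≠ 0 :=
  Complex.exp_ne_zero _

theorem eq_zero_of_torusCharacter_eq_one {k : Fin n → ℤ} (h : ∀ θ, torusCharacter k θ = 1) :
    k = 0 := by
  funext j
  by_contra hj
  have hj' : (k j : ℂ) ≠ 0 := by exact_mod_cast hj
  -- At this angle the character equals `exp (iπ) = -1`.
  have h1 := h (Pi.single j (Real.pi / k j))
  rw [torusCharacter, Finset.sum_eq_single j (fun i _ hi => by simp [hi]) (by simp)] at h1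
  rw [Pi.single_eq_same] at h1
  push_cast at h1
  rw [mul_div_cancel₀ _ hj', mul_comm, Complex.exp_pi_mul_I] at h1
  norm_num at h1

@[simp]
theorem torusRotation_zero (z : Fin n → ℂ) : torusRotation 0 z = z := by
  funext j; simp [torusRotation]

theorem torusRotation_torusRotation (θ η : Fin n → ℝ) (z : Fin n → ℂ) :
    torusRotation θ (torusRotation η z) = torusRotation (θ + η) z := by
  funext j
  simp only [torusRotation, ← mul_assoc, ← Complex.exp_add, Pi.add_apply, Complex.ofReal_add,
    mul_add]

@[fun_prop]
theorem differentiable_torusRotation (θ : Fin n → ℝ) : Differentiable ℂ (torusRotation θ) := by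
  unfold torusRotation
  fun_prop

theorem monomialFun_torusRotation (a : Fin n → ℕ) (θ : Fin n → ℝ) (z : Fin n → ℂ) :
    monomialFun a (torusRotation θ z) = torusCharacter (fun j => a j) θ * monomialFun a z := by
  simp only [monomialFun, torusRotation, torusCharacter, mul_pow, Finset.prod_mul_distrib,
    Finset.mul_sum, Complex.exp_sum]
  congr 1
  refine Finset.prod_congr rfl fun j _ => ?_
  rw [← Complex.exp_nat_mul]
  push_cast
  ring_nf

theorem measurePreserving_torusRotation (θ : Fin n → ℝ) :
    MeasurePreserving (torusRotation θ) volume volume := by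
  refine volume_preserving_pi (f := fun j (x : ℂ) => Complex.exp (Complex.I * θ j) * x) fun j => ?_
  have h := (rotation (Circle.exp (θ j))).measurePreserving
  have heq : (fun x : ℂ => Complex.exp (Complex.I * θ j) * x) = rotation (Circle.exp (θ j)) := by
    funext x
    simp [rotation_apply, mul_comm]
  rw [heq]
  exact h

namespace IsReinhardt

variable {Ω : Set (Fin n → ℂ)}

theorem torusRotation_mem (h : IsReinhardt Ω) (θ : Fin n → ℝ) {z : Fin n → ℂ} (hz : z ∈ Ω) :
    torusRotation θ z ∈ Ω := h z hz θ

theorem preimage_torusRotation (h : IsReinhardt Ω) (θ : Fin n → ℝ) : torusRotation θ ⁻¹' Ω = Ω := by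
  refine Subset.antisymm (fun z hz => ?_) fun z hz => h.torusRotation_mem θ hz
  have := h.torusRotation_mem (-θ) hz
  simpa [torusRotation_torusRotation] using this

theorem measurePreserving (h : IsReinhardt Ω) (hm : MeasurableSet Ω) (θ : Fin n → ℝ) :
    MeasurePreserving (torusRotation θ) (volume.restrict Ω) (volume.restrict Ω) := by
  have := (measurePreserving_torusRotation θ).restrict_preimage hm
  rwa [h.preimage_torusRotation] at this

end IsReinhardt

/-- `φ` transforms under the torus by the character with exponents `k`, almost everywhere. -/
def HasTorusWeight (μ : Measure (Fin n → ℂ)) (φ : (Fin n → ℂ) → ℂ) (k : Fin n → ℤ) : Prop :=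
  ∀ θ, ∀ᵐ z ∂μ, φ (torusRotation θ z) = torusCharacter k θ * φ z

/-- In polar coordinates a rotation only shifts the arguments. Passing to an almost everywhere equal
function is harmless since rotations preserve the measure on `Ω`. -/
theorem IsQuasiHomogeneousOn.exists_hasTorusWeight {Ω : Set (Fin n → ℂ)} (hΩ : IsReinhardt Ω)
    (hm : MeasurableSet Ω) {φ ψ : (Fin n → ℂ) → ℂ} (hψ : IsQuasiHomogeneousOn ψ Ω)
    (h : φ =ᵐ[volume.restrict Ω] ψ) : ∃ k, HasTorusWeight (volume.restrict Ω) φ k := by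
  obtain ⟨f, k, hk⟩ := hψ
  refine ⟨k, fun θ => ?_⟩
  have h2 := (hΩ.measurePreserving hm θ).quasiMeasurePreserving.ae h
  filter_upwards [h, h2, ae_restrict_mem hm] with z h1 h2 hz
  rw [h1, h2]
  have hpolar : ∀ η : Fin n → ℝ, torusRotation η z = fun j => ((‖z j‖₊ : ℝ) : ℂ) *
      Complex.exp (Complex.I * ((Complex.arg (z j) + η j : ℝ) : ℂ)) := by
    intro η
    funext j
    have := Complex.norm_mul_exp_arg_mul_I (z j)
    rw [torusRotation, coe_nnnorm]
    conv_lhs => rw [← this]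
    rw [Complex.ofReal_add, mul_add, Complex.exp_add, mul_comm (Complex.I) (Complex.arg (z j) : ℂ)]
    ring
  have key : ∀ η : Fin n → ℝ, ψ (torusRotation η z) = f (fun j => ‖z j‖₊) *
      Complex.exp (Complex.I * ∑ j, (k j : ℂ) * ((Complex.arg (z j) + η j : ℝ) : ℂ)) := by
    intro η
    have hmem := hΩ.torusRotation_mem η hz
    rw [hpolar η] at hmem ⊢
    exact hk (fun j => ‖z j‖₊) (fun j => Complex.arg (z j) + η j) hmem
  have key0 := key 0
  rw [torusRotation_zero] at key0
  rw [key θ, key0, torusCharacter]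
  simp only [Complex.ofReal_add, mul_add, Finset.sum_add_distrib, Complex.exp_add, Pi.zero_apply,
    Complex.ofReal_zero, mul_zero, Finset.sum_const_zero, Complex.exp_zero, mul_one]
  ring

theorem ae_forall_apply_ne_zero : ∀ᵐ z : Fin n → ℂ, ∀ i, z i ≠ 0 := by
  rw [ae_all_iff]
  intro i
  exact Measure.ae_eval_ne (μ := fun _ : Fin n => (volume : Measure ℂ)) i 0

theorem monomialFun_ne_zero {z : Fin n → ℂ} (hz : ∀ i, z i ≠ 0) (a : Fin n → ℕ) :
    monomialFun a z ≠ 0 :=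
  Finset.prod_ne_zero_iff.2 fun i _ => pow_ne_zero _ (hz i)

/-- The generator of a coordinate rotation is `I * z i` times the coordinate direction, so
invariance of a holomorphic function kills its `i`-th partial derivative where `z i ≠ 0`. -/
theorem hasDerivAt_torusRotation_single (i : Fin n) (z : Fin n → ℂ) :
    HasDerivAt (fun t : ℝ => torusRotation (Pi.single i t) z)
      ((Complex.I * z i) • (Pi.single i 1 : Fin n → ℂ)) 0 := by
  rw [hasDerivAt_pi]
  intro j
  rcases eq_or_ne j i with rfl | hj
  · have h1 : HasDerivAt (fun t : ℝ => Complex.exp (Complex.I * t)) Complex.I 0 := by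
      have h2 : HasDerivAt (fun t : ℝ => Complex.I * (t : ℂ)) Complex.I 0 := by
        simpa using (Complex.ofRealCLM.hasDerivAt (x := (0 : ℝ))).const_mul Complex.I
      simpa using h2.cexp
    simpa [torusRotation] using h1.mul_const (z j)
  · simpa [torusRotation, hj] using hasDerivAt_const (0 : ℝ) (z j)

/-- On a connected Reinhardt domain, a holomorphic function that transforms under the torus like a
monomial is a multiple of that monomial. -/
theorem exists_eqOn_const_mul_monomialFun {Ω : Set (Fin n → ℂ)}
    (ho : IsOpen Ω) (hc : IsConnected Ω) {h : (Fin n → ℂ) → ℂ} (hh : DifferentiableOn ℂ h Ω)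
    {b : Fin n → ℕ}
    (hw : ∀ θ, ∀ z ∈ Ω, h (torusRotation θ z) = torusCharacter (fun j => b j) θ * h z) :
    ∃ c : ℂ, ∀ z ∈ Ω, h z = c * monomialFun b z := by
  set V : Set (Fin n → ℂ) := Ω ∩ {z | ∀ i, z i ≠ 0} with hV
  have hVo : IsOpen V := by
    refine ho.inter ?_
    rw [ofPred_forall]
    exact isOpen_iInter_of_finite fun i => isOpen_ne_fun (continuous_apply i) continuous_const
  obtain ⟨p, hp⟩ : V.Nonempty := by
    by_contra hemp
    rw [not_nonempty_iff_eq_empty] at hemp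
    have h1 : volume Ω = 0 := by
      refine measure_mono_null (fun z hz => ?_) (ae_iff.1 (ae_forall_apply_ne_zero (n := n)))
      intro hz'
      exact (hemp ▸ (⟨hz, hz'⟩ : z ∈ V) : z ∈ (∅ : Set (Fin n → ℂ)))
    exact (ho.measure_pos volume hc.nonempty).ne' h1
  obtain ⟨r, hr, hball⟩ := Metric.isOpen_iff.1 hVo p hp
  set f : (Fin n → ℂ) → ℂ := fun z => h z / monomialFun b z with hf
  have hfd : ∀ z ∈ V, DifferentiableAt ℂ f z := fun z hz => by
    simp only [hf, div_eq_mul_inv]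
    exact ((hh z hz.1).differentiableAt (ho.mem_nhds hz.1)).mul
      ((differentiable_monomialFun b z).fun_inv (monomialFun_ne_zero hz.2 b))
  have hfinv : ∀ z ∈ V, ∀ θ, f (torusRotation θ z) = f z := fun z hz θ => by
    simp only [hf]
    rw [hw θ z hz.1, monomialFun_torusRotation, mul_div_mul_left _ _ (torusCharacter_ne_zero _ _)]
  have hf0 : ∀ z ∈ V, fderiv ℂ f z = 0 := by
    intro z hz
    have hpart : ∀ i, fderiv ℂ f z (Pi.single i 1) = 0 := by
      intro i
      have h1 : HasFDerivAt f ((fderiv ℂ f z).restrictScalars ℝ)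
          (torusRotation (Pi.single i (0 : ℝ)) z) := by
        rw [Pi.single_zero, torusRotation_zero]
        exact (hfd z hz).hasFDerivAt.restrictScalars ℝ
      have h2 := h1.comp_hasDerivAt (0 : ℝ) (hasDerivAt_torusRotation_single i z)
      have h3 : f ∘ (fun t : ℝ => torusRotation (Pi.single i t) z) = fun _ => f z :=
        funext fun t => hfinv z hz _
      rw [h3] at h2
      have h4 := h2.unique (hasDerivAt_const (0 : ℝ) (f z))
      rw [ContinuousLinearMap.coe_restrictScalars', map_smul, smul_eq_mul] at h4
      exact (mul_eq_zero.1 h4).resolve_left (mul_ne_zero Complex.I_ne_zero (hz.2 i))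
    ext v
    rw [pi_eq_sum_univ' v, map_sum]
    simp only [map_smul]
    simp [hpart]
  refine ⟨f p, fun z hz => ?_⟩
  -- The quotient is shown constant only on a ball, so connectedness of `V` is not needed; the
  -- identity theorem on `Ω` does the rest.
  have hev : (fun z => h z - f p * monomialFun b z) =ᶠ[𝓝 p] 0 := by
    filter_upwards [ball_mem_nhds p hr] with z hz
    have h1 : f z = f p := (convex_ball p r).is_const_of_fderivWithin_eq_zero (𝕜 := ℂ)
      (fun w hw => (hfd w (hball hw)).differentiableWithinAt)
      (fun w hw => by
        rw [fderivWithin_of_isOpen isOpen_ball hw, hf0 w (hball hw)]) hz (mem_ball_self hr)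
    rw [← h1]
    simp only [hf]
    rw [div_mul_cancel₀ _ (monomialFun_ne_zero (hball hz).2 b), sub_self]
    rfl
  have h2 := (hh.sub ((differentiable_monomialFun b).const_mul (f p)).differentiableOn
    ).eqOn_zero_of_isPreconnected ho hc.isPreconnected hp.1 hev hz
  exact sub_eq_zero.1 h2

end Rotation

/-! ### Toeplitz operators on monomials, and moments as Laplace transforms. -/

section Toeplitz

open Metric Set Filter Topology ComplexConjugate

variable {n : ℕ} {Ω : TopologicalSpace.Opens (Fin n → ℂ)}

theorem Bornology.IsBounded.exists_norm_le_on {s : Set (Fin n → ℂ)} (hb : Bornology.IsBounded s)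
    {g : (Fin n → ℂ) → ℂ} (hg : Continuous g) : ∃ C, ∀ z ∈ s, ‖g z‖ ≤ C := by
  obtain ⟨R, hR⟩ := hb.subset_closedBall 0
  obtain ⟨C, hC⟩ := (isCompact_closedBall (0 : Fin n → ℂ) R).exists_bound_of_continuousOn
    hg.continuousOn
  exact ⟨C, fun z hz => hC z (hR hz)⟩

theorem Bornology.IsBounded.isFiniteMeasure_restrict {s : Set (Fin n → ℂ)}
    (hb : Bornology.IsBounded s) : IsFiniteMeasure (volume.restrict s) :=
  ⟨by simpa using hb.measure_lt_top⟩

theorem memLp_restrict_of_continuous (hb : Bornology.IsBounded (Ω : Set (Fin n → ℂ)))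
    {g : (Fin n → ℂ) → ℂ} (hg : Continuous g) (p : ℝ≥0∞) :
    MemLp g p (volume.restrict (Ω : Set (Fin n → ℂ))) := by
  have := hb.isFiniteMeasure_restrict
  obtain ⟨C, hC⟩ := hb.exists_norm_le_on hg
  exact MemLp.of_bound hg.aestronglyMeasurable C
    ((ae_restrict_mem Ω.isOpen.measurableSet).mono fun z hz => hC z hz)

/-- The monomial `z ^ a` as an element of the Bergman space of a bounded domain. -/
noncomputable def bergmanMonomial (hb : Bornology.IsBounded (Ω : Set (Fin n → ℂ)))
    (a : Fin n → ℕ) : bergmanSpace Ω :=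
  ⟨(memLp_restrict_of_continuous hb (continuous_monomialFun a) 2).toLp _, monomialFun a,
    (differentiable_monomialFun a).differentiableOn, MemLp.coeFn_toLp _⟩

theorem coeFn_bergmanMonomial (hb : Bornology.IsBounded (Ω : Set (Fin n → ℂ))) (a : Fin n → ℕ) :
    ((bergmanMonomial hb a : bergmanSpace Ω) : Lp ℂ 2 (volume.restrict (Ω : Set (Fin n → ℂ))))
      =ᵐ[volume.restrict (Ω : Set (Fin n → ℂ))] monomialFun a :=
  MemLp.coeFn_toLp (memLp_restrict_of_continuous hb (continuous_monomialFun a) 2)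

/-- The moments of a function on `Ω`. -/
noncomputable def moment (Ω : TopologicalSpace.Opens (Fin n → ℂ)) (f : (Fin n → ℂ) → ℂ)
    (a b : Fin n → ℕ) : ℂ :=
  ∫ z in (Ω : Set (Fin n → ℂ)), f z * (monomialFun a z * conj (monomialFun b z))

theorem integrable_mul_continuous (hb : Bornology.IsBounded (Ω : Set (Fin n → ℂ)))
    (φ : Lp ℂ ∞ (volume.restrict (Ω : Set (Fin n → ℂ)))) {g : (Fin n → ℂ) → ℂ}
    (hg : Continuous g) :
    Integrable (fun z => φ z * g z) (volume.restrict (Ω : Set (Fin n → ℂ))) := by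
  have := hb.isFiniteMeasure_restrict
  have h1 : Integrable φ (volume.restrict (Ω : Set (Fin n → ℂ))) :=
    (Lp.memLp φ).integrable le_top
  obtain ⟨C, hC⟩ := hb.exists_norm_le_on hg
  exact h1.mul_bdd (c := C) hg.aestronglyMeasurable
    ((ae_restrict_mem Ω.isOpen.measurableSet).mono fun z hz => hC z hz)

theorem exists_moment_ne_zero (hb : Bornology.IsBounded (Ω : Set (Fin n → ℂ)))
    {φ : Lp ℂ ∞ (volume.restrict (Ω : Set (Fin n → ℂ)))} (hφ : φ ≠ 0) :
    ∃ a b, moment Ω φ a b ≠ 0 := by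
  by_contra! h
  refine hφ ?_
  rw [Lp.eq_zero_iff_ae_eq_zero]
  have hint := integrable_mul_continuous hb φ (g := fun _ => 1) continuous_const
  simp only [mul_one] at hint
  exact ae_eq_zero_of_moments Ω.isOpen hb hint h

/-- A function of weight `k` has nonzero moments only at exponents that differ by `k`. -/
theorem HasTorusWeight.eq_of_moment_ne_zero (hΩ : IsReinhardt (Ω : Set (Fin n → ℂ)))
    {φ : (Fin n → ℂ) → ℂ} {k : Fin n → ℤ}
    (hφ : HasTorusWeight (volume.restrict (Ω : Set (Fin n → ℂ))) φ k)
    (hφm : AEStronglyMeasurable φ (volume.restrict (Ω : Set (Fin n → ℂ))))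
    {a b : Fin n → ℕ} (h : moment Ω φ a b ≠ 0) (j : Fin n) : k j + a j = b j := by
  -- Rotating the variable preserves the integral yet multiplies it by this character; a nonzero
  -- moment can be cancelled.
  have hχ : ∀ θ, torusCharacter (k + (fun j => (a j : ℤ)) + -(fun j => (b j : ℤ))) θ = 1 := by
    intro θ
    refine mul_right_cancel₀ h ?_
    rw [one_mul]
    have hmp := hΩ.measurePreserving Ω.isOpen.measurableSet θ
    have h1 : moment Ω φ a b = ∫ z in (Ω : Set (Fin n → ℂ)), φ (torusRotation θ z) *
        (monomialFun a (torusRotation θ z) * conj (monomialFun b (torusRotation θ z))) := by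
      have hc : Continuous fun z : Fin n → ℂ => monomialFun a z * conj (monomialFun b z) := by
        fun_prop
      rw [moment]
      have hm : AEStronglyMeasurable (fun z => φ z * (monomialFun a z * conj (monomialFun b z)))
          (Measure.map (torusRotation θ) (volume.restrict (Ω : Set (Fin n → ℂ)))) := by
        rw [hmp.map_eq]
        exact hφm.mul hc.aestronglyMeasurable
      rw [← integral_map hmp.measurable.aemeasurable hm, hmp.map_eq]
    conv_rhs => rw [h1]
    rw [moment, ← integral_const_mul]
    refine integral_congr_ae ?_
    filter_upwards [hφ θ] with z hz
    rw [hz, monomialFun_torusRotation, monomialFun_torusRotation, torusCharacter_add,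
      torusCharacter_add, torusCharacter_neg, map_mul]
    ring
  have := congrFun (eq_zero_of_torusCharacter_eq_one hχ) j
  simp only [Pi.add_apply, Pi.neg_apply, Pi.zero_apply] at this
  omega

theorem coeFn_holderL_mul (φ : Lp ℂ ∞ (volume.restrict (Ω : Set (Fin n → ℂ))))
    (u : Lp ℂ 2 (volume.restrict (Ω : Set (Fin n → ℂ)))) :
    (ContinuousLinearMap.mul ℂ ℂ).holderL (volume.restrict (Ω : Set (Fin n → ℂ))) ∞ 2 2 φ u
      =ᵐ[volume.restrict (Ω : Set (Fin n → ℂ))] fun z => φ z * u z := by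
  rw [ContinuousLinearMap.holderL_apply_apply]
  exact ContinuousLinearMap.coeFn_holder _ _ _

/-- Against an element of the Bergman space the orthogonal projection drops out, so matrix entries
of Toeplitz operators are moments of the symbol. -/
theorem inner_toeplitz_bergmanMonomial (hb : Bornology.IsBounded (Ω : Set (Fin n → ℂ)))
    (φ : Lp ℂ ∞ (volume.restrict (Ω : Set (Fin n → ℂ)))) (a b : Fin n → ℕ) :
    inner ℂ (bergmanMonomial hb b) (toeplitz Ω φ (bergmanMonomial hb a)) = moment Ω φ a b := by
  simp only [toeplitz, bergmanProjection, ContinuousLinearMap.comp_apply]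
  rw [Submodule.inner_orthogonalProjectionOnto_eq_of_mem_left, L2.inner_def, moment]
  refine integral_congr_ae ?_
  filter_upwards [coeFn_bergmanMonomial hb a, coeFn_bergmanMonomial hb b,
    coeFn_holderL_mul φ (bergmanMonomial hb a : bergmanSpace Ω)] with z h1 h2 h3
  simp only [Submodule.subtypeL_apply]
  rw [h2, h3, h1, RCLike.inner_apply]
  ring

/-- A Toeplitz operator whose symbol has weight `k` maps `z ^ a` to a multiple of `z ^ (a + k)`. -/
theorem exists_toeplitz_bergmanMonomial_eq_smul (hb : Bornology.IsBounded (Ω : Set (Fin n → ℂ)))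
    (hΩ : IsReinhardt (Ω : Set (Fin n → ℂ))) (hc : IsConnected (Ω : Set (Fin n → ℂ)))
    {φ : Lp ℂ ∞ (volume.restrict (Ω : Set (Fin n → ℂ)))} {k : Fin n → ℤ}
    (hφ : HasTorusWeight (volume.restrict (Ω : Set (Fin n → ℂ))) φ k)
    {a b : Fin n → ℕ} (hab : ∀ j, k j + a j = b j) :
    ∃ c : ℂ, toeplitz Ω φ (bergmanMonomial hb a) = c • bergmanMonomial hb b := by
  let μ := volume.restrict (Ω : Set (Fin n → ℂ))
  have hmp := hΩ.measurePreserving Ω.isOpen.measurableSet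
  set W : (Fin n → ℝ) → Lp ℂ 2 μ →ₗᵢ[ℂ] Lp ℂ 2 μ := fun θ =>
    Lp.compMeasurePreservingₗᵢ ℂ (torusRotation θ) (hmp θ) with hW
  have hWcoe : ∀ θ u, W θ u =ᵐ[μ] fun z => u (torusRotation θ z) := fun θ u =>
    Lp.coeFn_compMeasurePreserving u (hmp θ)
  have hWmem : ∀ θ, ∀ u ∈ bergmanSpace Ω, W θ u ∈ bergmanSpace Ω := by
    rintro θ u ⟨f, hf, huf⟩
    refine ⟨fun z => f (torusRotation θ z), hf.comp
      (differentiable_torusRotation θ).differentiableOn fun z hz => hΩ.torusRotation_mem θ hz, ?_⟩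
    exact (hWcoe θ u).trans ((hmp θ).quasiMeasurePreserving.ae_eq_comp huf)
  have hWinv : ∀ θ u, W θ (W (-θ) u) = u := by
    intro θ u
    refine Lp.ext ?_
    refine (hWcoe θ _).trans ?_
    filter_upwards [(hmp θ).quasiMeasurePreserving.ae_eq_comp (hWcoe (-θ) u)] with z hz
    simp only [Function.comp_apply, torusRotation_torusRotation, neg_add_cancel,
      torusRotation_zero] at hz
    exact hz
  set w : Lp ℂ 2 μ := (ContinuousLinearMap.mul ℂ ℂ).holderL μ ∞ 2 2 φ
    (bergmanMonomial hb a : bergmanSpace Ω) with hw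
  set χ : (Fin n → ℝ) → ℂ := torusCharacter fun j => (b j : ℤ) with hχ
  have hWw : ∀ θ, W θ w = χ θ • w := by
    intro θ
    have h1 : w =ᵐ[μ] fun z => φ z * monomialFun a z := by
      filter_upwards [coeFn_holderL_mul φ (bergmanMonomial hb a : bergmanSpace Ω),
        coeFn_bergmanMonomial hb a] with z h1 h2
      rw [h1, h2]
    refine Lp.ext ?_
    filter_upwards [hWcoe θ w, (hmp θ).quasiMeasurePreserving.ae_eq_comp h1, h1,
      Lp.coeFn_smul (χ θ) w, hφ θ] with z h2 h3 h4 h5 h6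
    simp only [Function.comp_apply] at h3
    rw [h2, h3, h5, Pi.smul_apply, h4, h6, monomialFun_torusRotation, smul_eq_mul, hχ,
      show (fun j => (b j : ℤ)) = k + fun j => (a j : ℤ) from funext fun j => (hab j).symm,
      torusCharacter_add]
    ring
  set u : bergmanSpace Ω := toeplitz Ω φ (bergmanMonomial hb a) with hu
  have huw : u = (bergmanSpace Ω).orthogonalProjectionOnto w := rfl
  have hWu : ∀ θ, W θ (u : Lp ℂ 2 μ) = χ θ • (u : Lp ℂ 2 μ) := by
    intro θ
    -- The projection commutes with rotations: they are invertible isometries of `L²` that preserve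
    -- the Bergman space.
    have h1 : (bergmanSpace Ω).orthogonalProjectionOnto (W θ w) = ⟨W θ u, hWmem θ _ u.2⟩ := by
      refine ext_inner_left ℂ fun v => ?_
      rw [Submodule.inner_orthogonalProjectionOnto_eq_of_mem_left]
      change _ = inner ℂ (v : Lp ℂ 2 μ) (W θ u)
      rw [← hWinv θ v, LinearIsometry.inner_map_map, LinearIsometry.inner_map_map]
      exact (Submodule.inner_orthogonalProjectionOnto_eq_of_mem_left
        (⟨W (-θ) v, hWmem _ _ v.2⟩ : bergmanSpace Ω) w).symm
    rw [hWw, map_smul, ← huw] at h1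
    exact (congrArg Subtype.val h1).symm
  obtain ⟨h, hh, huh⟩ := u.2
  have hrot : ∀ θ, ∀ z ∈ (Ω : Set (Fin n → ℂ)), h (torusRotation θ z) = χ θ * h z := by
    intro θ
    refine Measure.eqOn_open_of_ae_eq (μ := volume) ?_ Ω.isOpen
      (hh.comp (differentiable_torusRotation θ).differentiableOn
        fun z hz => hΩ.torusRotation_mem θ hz).continuousOn
      (hh.const_mul (χ θ)).continuousOn
    have h1 := hWcoe θ u
    rw [hWu θ] at h1
    filter_upwards [h1, (hmp θ).quasiMeasurePreserving.ae_eq_comp huh, huh,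
      Lp.coeFn_smul (χ θ) (u : Lp ℂ 2 μ)] with z h2 h3 h4 h5
    simp only [Function.comp_apply] at h3
    rw [← h3, ← h2, h5, Pi.smul_apply, h4, smul_eq_mul]
  obtain ⟨c, hcz⟩ := exists_eqOn_const_mul_monomialFun Ω.isOpen hc hh hrot
  refine ⟨c, Subtype.ext (Lp.ext ?_)⟩
  filter_upwards [huh, coeFn_bergmanMonomial hb b,
    Lp.coeFn_smul c ((bergmanMonomial hb b : bergmanSpace Ω) : Lp ℂ 2 μ),
    ae_restrict_mem Ω.isOpen.measurableSet] with z h1 h2 h3 hz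
  refine (h1.trans (hcz z hz)).trans ?_
  change _ = (c • ((bergmanMonomial hb b : bergmanSpace Ω) : Lp ℂ 2 μ) : Lp ℂ 2 μ) z
  rw [h3, Pi.smul_apply, h2, smul_eq_mul]

/-- The logarithms of the moduli of the coordinates, scaled and truncated so as to be nonpositive. -/
noncomputable def logModulus (R : ℝ) (i : Fin n) (z : Fin n → ℂ) : ℝ :=
  min 0 (Real.log (‖z i‖ / R))

theorem measurable_logModulus (R : ℝ) (i : Fin n) : Measurable (logModulus R i) :=
  measurable_const.min (Real.measurable_log.comp (by fun_prop))

/-- On `Ω` every `|z i| / R` is at most `1`, so the truncation is inactive, and off the null set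
where a coordinate vanishes the kernel is `∏ (|z i| / R) ^ (2 * d i)`. The factor `2` makes `|z i| ^
(2 * d i)` a product of a monomial and its conjugate. -/
theorem laplaceTransform_logModulus {R : ℝ} (hR : 0 < R)
    (hΩR : (Ω : Set (Fin n → ℂ)) ⊆ closedBall 0 R) (φ : (Fin n → ℂ) → ℂ) (a b d : Fin n → ℕ) :
    laplaceTransform (volume.restrict (Ω : Set (Fin n → ℂ))) (logModulus R)
      (fun z => φ z * (monomialFun a z * conj (monomialFun b z))) (fun i => 2 * d i) =
    (∏ i, ((R : ℂ) ^ 2)⁻¹ ^ d i) * moment Ω φ (d + a) (d + b) := by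
  rw [laplaceTransform, moment, ← integral_const_mul]
  refine integral_congr_ae ?_
  filter_upwards [ae_restrict_mem Ω.isOpen.measurableSet,
    ae_restrict_of_ae (ae_forall_apply_ne_zero (n := n))] with z hz hz0
  have h1 : ∀ i, Complex.exp (2 * d i * (logModulus R i z : ℂ)) =
      ((R : ℂ) ^ 2)⁻¹ ^ d i * (z i ^ d i * conj (z i ^ d i)) := by
    intro i
    have hpos : 0 < ‖z i‖ / R := div_pos (norm_pos_iff.2 (hz0 i)) hR
    have hle : ‖z i‖ / R ≤ 1 := by
      rw [div_le_one hR]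
      exact (norm_le_pi_norm z i).trans (by simpa using hΩR hz)
    rw [logModulus, min_eq_right (Real.log_nonpos hpos.le hle)]
    rw [show (2 * d i * (Real.log (‖z i‖ / R) : ℂ) : ℂ) =
      ((2 * d i : ℕ) : ℂ) * (Real.log (‖z i‖ / R) : ℂ) by push_cast; ring, Complex.exp_nat_mul,
      ← Complex.ofReal_exp, Real.exp_log hpos, map_pow, ← mul_pow, ← mul_pow, pow_mul,
      Complex.mul_conj, Complex.normSq_eq_norm_sq]
    congr 1
    push_cast
    rw [div_pow]
    ring
  rw [Complex.exp_sum, Finset.prod_congr rfl fun i _ => h1 i]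
  simp only [Finset.prod_mul_distrib, ← map_prod]
  rw [monomialFun_add, monomialFun_add, map_mul]
  simp only [monomialFun]
  ring

end Toeplitz

/-! ### The path of exponents and the contradiction. -/

theorem corollary1p2 {n m : ℕ} (hm : 1 ≤ m)
    (Ω : TopologicalSpace.Opens (Fin n → ℂ))
    (hconn : IsConnected (Ω : Set (Fin n → ℂ)))
    (hbdd : Bornology.IsBounded (Ω : Set (Fin n → ℂ)))
    (hΩ : IsReinhardt (Ω : Set (Fin n → ℂ)))
    (φ : Fin m → Lp ℂ ∞ (volume.restrict (Ω : Set (Fin n → ℂ))))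
    (hφ : ∀ j : Fin m, (j : ℕ) + 1 < m →
      ∃ ψ : (Fin n → ℂ) → ℂ, IsQuasiHomogeneousOn ψ (Ω : Set (Fin n → ℂ)) ∧
        φ j =ᵐ[volume.restrict (Ω : Set (Fin n → ℂ))] ψ)
    (hprod : (List.ofFn fun j : Fin m => toeplitz Ω (φ j)).reverse.prod = 0) :
    ∃ j : Fin m, φ j = 0 := by
  classical
  by_contra! hne
  choose a b hab using fun j => exists_moment_ne_zero hbdd (hne j)
  obtain ⟨R', hR'⟩ := hbdd.subset_closedBall 0
  set R := max R' 1
  have hR : 0 < R := lt_of_lt_of_le one_pos (le_max_right _ _)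
  have hΩR : (Ω : Set (Fin n → ℂ)) ⊆ Metric.closedBall 0 R :=
    hR'.trans (Metric.closedBall_subset_closedBall (le_max_left _ _))
  -- The part of the path shared by both ends of step `j`: factors already applied contribute `b`,
  -- later ones `a`, and `j` itself nothing.
  set e : Fin m → Fin n → ℕ := fun j =>
    ∑ l, if l < j then b l else if l = j then 0 else a l with he
  suffices hzero : ∀ δ : Fin n → ℕ, (∀ i, 1 ≤ δ i) →
      ∏ j, laplaceTransform (volume.restrict (Ω : Set (Fin n → ℂ))) (logModulus R)
        (fun z => φ j z * (monomialFun (a j) z * starRingEnd ℂ (monomialFun (b j) z)))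
        (fun i => 2 * (δ i + e j i)) = 0 by
    obtain ⟨j, hj⟩ := exists_integral_eq_zero_of_prod_laplaceTransform_eq_zero
      (fun j => integrable_mul_continuous hbdd (φ j) (by fun_prop)) (measurable_logModulus R)
      (fun i z => min_le_left _ _) e hzero
    exact hab j hj
  intro δ _
  by_contra hG
  have hG' : ∀ j, moment Ω (φ j) (δ + e j + a j) (δ + e j + b j) ≠ 0 := by
    intro j h0
    refine hG (Finset.prod_eq_zero (Finset.mem_univ j) ?_)
    have h1 := laplaceTransform_logModulus hR hΩR (φ j) (a j) (b j) (δ + e j)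
    rw [h0, mul_zero] at h1
    rw [← h1]
    congr 1
    funext i
    simp
  -- Step `j` replaces `a j` by `b j`, changing the exponent by the weight of `φ j` while every
  -- entry stays a natural number.
  set α : ℕ → Fin n → ℕ := fun t => δ + ∑ l : Fin m, if (l : ℕ) < t then b l else a l with hα
  have hαa : ∀ j : Fin m, α j = δ + e j + a j := by
    intro j
    simp only [hα, he, add_assoc]
    rw [← Finset.add_sum_erase _ _ (Finset.mem_univ j),
      ← Finset.add_sum_erase (a := j) _ (fun l => if l < j then b l else if l = j then 0 else a l)
        (Finset.mem_univ j)]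
    simp only [lt_irrefl, if_false, if_true, zero_add]
    rw [add_comm (a j)]
    congr 2
    refine Finset.sum_congr rfl fun l hl => ?_
    simp [Finset.ne_of_mem_erase hl]
  have hαb : ∀ j : Fin m, α (j + 1) = δ + e j + b j := by
    intro j
    simp only [hα, he, add_assoc]
    rw [← Finset.add_sum_erase _ _ (Finset.mem_univ j),
      ← Finset.add_sum_erase (a := j) _ (fun l => if l < j then b l else if l = j then 0 else a l)
        (Finset.mem_univ j)]
    simp only [lt_irrefl, if_false, if_true, zero_add, Nat.lt_succ_self]
    rw [add_comm (b j)]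
    congr 2
    refine Finset.sum_congr rfl fun l hl => ?_
    have hlj := Finset.ne_of_mem_erase hl
    have : ((l : ℕ) < j + 1) ↔ l < j := by
      have h1 : (l : ℕ) ≠ j := fun h => hlj (Fin.ext h)
      rw [Fin.lt_def]
      omega
    simp [hlj, this]
  have hstep : ∀ j : Fin m, (j : ℕ) + 1 < m → ∃ c : ℂ, c ≠ 0 ∧
      toeplitz Ω (φ j) (bergmanMonomial hbdd (α j)) = c • bergmanMonomial hbdd (α (j + 1)) := by
    intro j hjm
    obtain ⟨ψ, hψ, hφψ⟩ := hφ j hjm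
    obtain ⟨k, hk⟩ := hψ.exists_hasTorusWeight hΩ Ω.isOpen.measurableSet hφψ
    have hkab := hk.eq_of_moment_ne_zero hΩ (Lp.aestronglyMeasurable _) (hab j)
    obtain ⟨c, hc⟩ := exists_toeplitz_bergmanMonomial_eq_smul hbdd hΩ hconn hk
      (a := α j) (b := α (j + 1)) (fun i => by
        have := hkab i
        rw [hαa, hαb]
        simp only [Pi.add_apply]
        push_cast
        linarith)
    refine ⟨c, ?_, hc⟩
    rintro rfl
    refine hG' j ?_
    rw [← hαa, ← hαb, ← inner_toeplitz_bergmanMonomial hbdd, hc, zero_smul, inner_zero_right]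
  set L := List.ofFn fun j : Fin m => toeplitz Ω (φ j) with hL
  have hlen : L.length = m := List.length_ofFn
  have htake : ∀ t, (ht : t < m) → (L.take (t + 1)).reverse.prod =
      toeplitz Ω (φ ⟨t, ht⟩) * (L.take t).reverse.prod := by
    intro t ht
    rw [List.take_succ_eq_append_getElem (by rw [hlen]; exact ht), List.reverse_append]
    simp [hL]
  -- The bound stops before the last operator, whose symbol need not have a weight.
  have hiter : ∀ t, t + 1 ≤ m → ∃ C : ℂ, C ≠ 0 ∧ (L.take t).reverse.prod
      (bergmanMonomial hbdd (α 0)) = C • bergmanMonomial hbdd (α t) := by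
    intro t
    induction t with
    | zero => exact fun _ => ⟨1, one_ne_zero, by simp⟩
    | succ t ih =>
      intro ht
      obtain ⟨C, hC, hCt⟩ := ih (by omega)
      obtain ⟨c, hc, hct⟩ := hstep ⟨t, by omega⟩ ht
      refine ⟨C * c, mul_ne_zero hC hc, ?_⟩
      rw [htake t (by omega), mul_apply_eq_comp, hCt, map_smul, hct, smul_smul]
  obtain ⟨t, rfl⟩ : ∃ t, m = t + 1 := ⟨m - 1, by omega⟩
  obtain ⟨C, hC, hCt⟩ := hiter t le_rfl
  have h1 := htake t (Nat.lt_succ_self t)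
  rw [List.take_of_length_le hlen.le, hprod] at h1
  have h2 := congrArg (fun T => T (bergmanMonomial hbdd (α 0))) h1
  simp only [mul_apply_eq_comp, hCt, map_smul, zero_apply] at h2
  -- The last operator kills a monomial, so all its moments against that monomial vanish, including
  -- the one assumed nonzero.
  have h3 := (smul_eq_zero.1 h2.symm).resolve_left hC
  refine hG' ⟨t, Nat.lt_succ_self t⟩ ?_
  rw [← hαa, ← hαb, ← inner_toeplitz_bergmanMonomial hbdd]
  change inner ℂ _ (toeplitz Ω (φ ⟨t, _⟩) (bergmanMonomial hbdd (α t))) = 0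
  rw [h3, inner_zero_right]
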